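/- Let $P=\{x\in\mathbb R^n:\langle a_i,x\rangle\le b_i,\ i=1,\dots,m\}$ be an $n$-dimensional pointed polyhedron (the rows $a_i$ span $\mathbb R^n$). For a vertex $v$ of $P$ let $N_v$ be the normal cone of $P$ at $v$, that is, the cone generated by the rows $a_i$ with $\langle a_i,v\rangle=b_i$, and let $N(P)=\bigcup_v N_v$ be the support of the normal fan. Let $\tau>0$ and assume that $P$ is $\tau$-wide: every $N_v$ contains a closed Euclidean ball of radius $\tau$ centred at a unit vector. Then: (1) The graph of $P$ (vertices and bounded edges of $P$) is connected and its diameter is at most $$\frac{8n}{\tau}\Bigl(1+\ln\frac1\tau\Bigr).$$ (2) A path of this expected length is given by the shadow simplex method. Let $v\ne w$ be vertices of $P$, let $u_v,u_w$ be any unit vectors with $u_v+\tau B\subseteq N_v$ and $u_w+\tau B\subseteq N_w$, where $B$ is the closed unit ball, and put $s=4n/\|u_w-u_v\|$, $c=s\,u_v$, $d=s\,u_w$. Let $X$ have the exponential distribution on $N(P)$, i.e. the probability density proportional to $e^{-\|x\|}$ on $N(P)$ and $0$ elsewhere, conditioned on the event $\|X\|\le 2n$ (which has positive probability). Then almost surely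 the vertices optimizing the objectives met along the three consecutive segments $$c\longrightarrow c+X\longrightarrow d+X\longrightarrow d$$ form a path from $v$ to $w$ in the graph of $P$: except at finitely many points of each segment, none of them an end of the segment, where the optimal face is the edge along which one pivots, the objectives of the relatively open segment have a unique optimal vertex. The expected length (number of pivots) of this path is at most $\frac{8n}{\tau}\bigl(1+\ln\frac1\tau\bigr)$. -/

import Mathlib

open MeasureTheory ProbabilityTheory

noncomputable section

/-- The polyhedron `{x ∈ ℝⁿ : ⟨aᵢ, x⟩ ≤ bᵢ for all i}` with constraint rows `a i`. -/
def polyhedron {m n : ℕ} (a : Fin m → EuclideanSpace ℝ (Fin n)) (b : Fin m → ℝ) :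
    Set (EuclideanSpace ℝ (Fin n)) :=
  {x | ∀ i, inner ℝ (a i) x ≤ b i}

/-- The constraint matrix has full column rank, i.e. its rows span `ℝⁿ`. For a nonempty
polyhedron this says that it is pointed (has a vertex). -/
def IsPointedSystem {m n : ℕ} (a : Fin m → EuclideanSpace ℝ (Fin n)) : Prop :=
  Submodule.span ℝ (Set.range a) = ⊤

/-- The normal cone at `v`: all nonnegative combinations of the rows that are tight at `v`. -/
def normalCone {m n : ℕ} (a : Fin m → EuclideanSpace ℝ (Fin n)) (b : Fin m → ℝ)
    (v : EuclideanSpace ℝ (Fin n)) : Set (EuclideanSpace ℝ (Fin n)) :=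
  (PointedCone.hull ℝ (a '' {i | inner ℝ (a i) v = b i}) :
    PointedCone ℝ (EuclideanSpace ℝ (Fin n)))

/-- The support of the normal fan: the union of the vertex normal cones. -/
def fanSupport {m n : ℕ} (a : Fin m → EuclideanSpace ℝ (Fin n)) (b : Fin m → ℝ) :
    Set (EuclideanSpace ℝ (Fin n)) :=
  ⋃ v ∈ (polyhedron a b).extremePoints ℝ, normalCone a b v

/-- A polyhedron is `τ`-wide if every vertex normal cone contains a Euclidean ball of radius `τ`
centred on the unit sphere. -/
def IsWidePolyhedron {m n : ℕ} (a : Fin m → EuclideanSpace ℝ (Fin n)) (b : Fin m → ℝ)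
    (τ : ℝ) : Prop :=
  ∀ v ∈ (polyhedron a b).extremePoints ℝ,
    ∃ u : EuclideanSpace ℝ (Fin n), ‖u‖ = 1 ∧ Metric.closedBall u τ ⊆ normalCone a b v

/-- The graph (1-skeleton) of a convex set `P`: the vertices are the extreme points, and two
distinct vertices are adjacent if the segment between them is a face of `P`. -/
def vertexGraph {n : ℕ} (P : Set (EuclideanSpace ℝ (Fin n))) :
    SimpleGraph (P.extremePoints ℝ) where
  Adj v w := v ≠ w ∧
    IsExtreme ℝ P (segment ℝ (v : EuclideanSpace ℝ (Fin n)) (w : EuclideanSpace ℝ (Fin n)))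
  symm := ⟨fun v w h => ⟨h.1.symm, by rw [segment_symm]; exact h.2⟩⟩
  loopless := ⟨fun v h => h.1 rfl⟩

/-- The density `c · exp (-‖x‖)` on the cone `S` (zero outside), normalized by
`c = 1 / ∫_S exp (-‖x‖) dx`. -/
def expDensity {n : ℕ} (S : Set (EuclideanSpace ℝ (Fin n))) (x : EuclideanSpace ℝ (Fin n)) : ℝ :=
  S.indicator (fun x => (∫ y in S, Real.exp (-‖y‖))⁻¹ * Real.exp (-‖x‖)) x

/-- The exponential distribution on the cone `S`. -/
def expLaw {n : ℕ} (S : Set (EuclideanSpace ℝ (Fin n))) : Measure (EuclideanSpace ℝ (Fin n)) :=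
  volume.withDensity (fun x => ENNReal.ofReal (expDensity S x))

/-- The set of points of `P` that maximize the linear objective `c` over `P`. -/
def optimalFace {n : ℕ} (P : Set (EuclideanSpace ℝ (Fin n))) (c : EuclideanSpace ℝ (Fin n)) :
    Set (EuclideanSpace ℝ (Fin n)) :=
  {x ∈ P | ∀ y ∈ P, inner ℝ c y ≤ inner ℝ c x}

/-- `p` is the shadow simplex path of `P` for the segment of objectives `[c, d]`.
There are breakpoints `0 = t 0 < t 1 < ⋯ < t (p.length + 1) = 1` such that the `i`-th vertex of
`p` is the unique optimum for the objectives `(1 - r) c + r d` with `t i < r < t (i + 1)`, and at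
each interior breakpoint the optimal face is the edge along which the pivot is made. -/
def IsShadowPath {n : ℕ} (P : Set (EuclideanSpace ℝ (Fin n))) (c d : EuclideanSpace ℝ (Fin n))
    {v w : P.extremePoints ℝ} (p : (vertexGraph P).Walk v w) : Prop :=
  ∃ t : ℕ → ℝ, t 0 = 0 ∧ t (p.length + 1) = 1 ∧
    (∀ i ≤ p.length, t i < t (i + 1) ∧
      ∀ r ∈ Set.Ioo (t i) (t (i + 1)),
        optimalFace P (AffineMap.lineMap c d r) =
          {((p.getVert i : P.extremePoints ℝ) : EuclideanSpace ℝ (Fin n))}) ∧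
    ∀ i < p.length,
      optimalFace P (AffineMap.lineMap c d (t (i + 1))) =
        segment ℝ ((p.getVert i : P.extremePoints ℝ) : EuclideanSpace ℝ (Fin n))
          ((p.getVert (i + 1) : P.extremePoints ℝ) : EuclideanSpace ℝ (Fin n))

/-- `p` is the concatenation of three shadow simplex paths, for the segments of objectives
`[c, c + x]`, `[c + x, d + x]` and `[d + x, d]`. -/
def IsThreeLegShadowPath {n : ℕ} (P : Set (EuclideanSpace ℝ (Fin n)))
    (c d x : EuclideanSpace ℝ (Fin n)) {v w : P.extremePoints ℝ}
    (p : (vertexGraph P).Walk v w) : Prop :=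
  ∃ (v' w' : P.extremePoints ℝ) (p₁ : (vertexGraph P).Walk v v')
    (p₂ : (vertexGraph P).Walk v' w') (p₃ : (vertexGraph P).Walk w' w),
    IsShadowPath P c (c + x) p₁ ∧ IsShadowPath P (c + x) (d + x) p₂ ∧
      IsShadowPath P (d + x) d p₃ ∧ p = p₁.append (p₂.append p₃)

end

section Polyhedron

variable {m n : ℕ} {a : Fin m → EuclideanSpace ℝ (Fin n)} {b : Fin m → ℝ}

lemma IsPointedSystem.eq_zero (h : IsPointedSystem a) {z : EuclideanSpace ℝ (Fin n)}
    (hz : ∀ i, inner ℝ (a i) z = 0) : z = 0 := by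
  have hmem : z ∈ (Submodule.span ℝ (Set.range a))ᗮ := by
    rw [Submodule.mem_orthogonal]
    intro u hu
    induction hu using Submodule.span_induction with
    | mem x hx => obtain ⟨i, rfl⟩ := hx; exact hz i
    | zero => simp
    | add x y _ _ hx hy => rw [inner_add_left, hx, hy, add_zero]
    | smul r x _ hx => rw [inner_smul_left, hx, mul_zero]
  rw [IsPointedSystem] at h
  rw [h, Submodule.top_orthogonal_eq_bot] at hmem
  simpa using hmem

lemma isClosed_polyhedron : IsClosed (polyhedron a b) := by
  have : polyhedron a b = ⋂ i, {x | inner ℝ (a i) x ≤ b i} := by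
    ext x; simp [polyhedron]
  rw [this]
  exact isClosed_iInter fun i => isClosed_le (by fun_prop) continuous_const

lemma convex_polyhedron : Convex ℝ (polyhedron a b) := by
  intro x hx y hy s t hs ht hst i
  rw [inner_add_right, inner_smul_right, inner_smul_right]
  calc s * inner ℝ (a i) x + t * inner ℝ (a i) y ≤ s * b i + t * b i :=
        add_le_add (mul_le_mul_of_nonneg_left (hx i) hs) (mul_le_mul_of_nonneg_left (hy i) ht)
    _ = b i := by rw [← add_mul, hst, one_mul]

/-- At an extreme point only the zero vector is orthogonal to all tight rows. -/
lemma eq_zero_of_mem_extremePoints {x z : EuclideanSpace ℝ (Fin n)}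
    (hx : x ∈ (polyhedron a b).extremePoints ℝ)
    (hz : ∀ i, inner ℝ (a i) x = b i → inner ℝ (a i) z = 0) : z = 0 := by
  have hev : ∀ᶠ t : ℝ in nhds 0, x + t • z ∈ polyhedron a b ∧ x - t • z ∈ polyhedron a b := by
    simp only [polyhedron, Set.mem_ofPred_eq, ← forall_and]
    refine Filter.eventually_all.2 fun i => ?_
    rcases (hx.1 i).eq_or_lt with h | h
    · refine Filter.Eventually.of_forall fun t => ?_
      rw [inner_add_right, inner_sub_right, inner_smul_right, hz i h]
      simp [h]
    · refine Filter.Eventually.and ?_ ?_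
      · have hc : Continuous fun t : ℝ => inner ℝ (a i) (x + t • z) := by fun_prop
        exact ((hc.tendsto 0).eventually_lt_const (by simpa using h)).mono fun t ht => ht.le
      · have hc : Continuous fun t : ℝ => inner ℝ (a i) (x - t • z) := by fun_prop
        exact ((hc.tendsto 0).eventually_lt_const (by simpa using h)).mono fun t ht => ht.le
  obtain ⟨ε, hε, hball⟩ := Metric.eventually_nhds_iff.1 hev
  have hP := @hball (ε / 2) (by rw [Real.dist_eq, sub_zero, abs_of_pos (by positivity)]; linarith)
  have := hx.2 hP.1 hP.2 ⟨1 / 2, 1 / 2, by norm_num, by norm_num, by norm_num, by module⟩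
  have h2 : (ε / 2) • z = 0 := by simpa using this
  exact (smul_eq_zero.1 h2).resolve_left (by positivity)

lemma mem_extremePoints_of_tight {x : EuclideanSpace ℝ (Fin n)} (hx : x ∈ polyhedron a b)
    (h : ∀ z, (∀ i, inner ℝ (a i) x = b i → inner ℝ (a i) z = 0) → z = 0) :
    x ∈ (polyhedron a b).extremePoints ℝ := by
  refine mem_extremePoints_iff_left.2 ⟨hx, fun y hy z hz hseg => ?_⟩
  obtain ⟨s, t, hs, ht, hst, rfl⟩ := hseg
  rw [← sub_eq_zero]
  refine h _ fun i hi => ?_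
  rw [inner_add_right, inner_smul_right, inner_smul_right] at hi
  rw [inner_sub_right, inner_add_right, inner_smul_right, inner_smul_right, hi]
  have h1 := mul_le_mul_of_nonneg_left (hy i) hs.le
  have h2 := mul_le_mul_of_nonneg_left (hz i) ht.le
  have h3 : s * b i + t * b i = b i := by rw [← add_mul, hst, one_mul]
  have h4 : s * inner ℝ (a i) y = s * b i := by linarith
  linarith [mul_left_cancel₀ hs.ne' h4]

lemma finite_extremePoints_polyhedron : ((polyhedron a b).extremePoints ℝ).Finite := by
  refine Set.Finite.of_injOn (f := fun v => {i | inner ℝ (a i) v = b i}) (t := Set.univ)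
    (fun _ _ => Set.mem_univ _) (fun v hv w hw hvw => ?_) Set.finite_univ
  rw [← sub_eq_zero]
  refine eq_zero_of_mem_extremePoints hv fun i hi => ?_
  have hw' : inner ℝ (a i) w = b i := (Set.ext_iff.1 hvw i).1 hi
  rw [inner_sub_right, hi, hw', sub_self]

/-- A linear functional that is bounded above on a pointed polyhedron is dominated by its values
at the extreme points. -/
lemma exists_extremePoint_inner_ge (hp : IsPointedSystem a) {c : EuclideanSpace ℝ (Fin n)}
    {M : ℝ} (hM : ∀ y ∈ polyhedron a b, inner ℝ c y ≤ M) {x : EuclideanSpace ℝ (Fin n)}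
    (hx : x ∈ polyhedron a b) :
    ∃ v ∈ (polyhedron a b).extremePoints ℝ, inner ℝ c x ≤ inner ℝ c v := by
  classical
  induction hk : (Finset.univ.filter fun i => inner ℝ (a i) x ≠ b i).card
    using Nat.strong_induction_on generalizing x with
  | _ k ih =>
  by_cases hext : ∀ z, (∀ i, inner ℝ (a i) x = b i → inner ℝ (a i) z = 0) → z = 0
  · exact ⟨x, mem_extremePoints_of_tight hx hext, le_rfl⟩
  push Not at hext
  obtain ⟨z, hz, hz0⟩ := hext
  have hpos : ∃ z, (∀ i, inner ℝ (a i) x = b i → inner ℝ (a i) z = 0) ∧ 0 ≤ inner ℝ c z ∧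
      ∃ i, 0 < inner ℝ (a i) z := by
    have key : ∀ z, 0 < inner ℝ c z → ∃ i, 0 < inner ℝ (a i) z := by
      intro z hcz
      by_contra! hneg
      have hray : ∀ t : ℝ, 0 ≤ t → x + t • z ∈ polyhedron a b := fun t ht i => by
        rw [inner_add_right, inner_smul_right]
        have := mul_nonpos_of_nonneg_of_nonpos ht (hneg i)
        linarith [hx i]
      have h1 := hM _ hx
      have h2 := hM _ (hray ((M - inner ℝ c x + 1) / inner ℝ c z) (by
        apply div_nonneg _ hcz.le; linarith))
      rw [inner_add_right, inner_smul_right, div_mul_cancel₀ _ hcz.ne'] at h2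
      linarith
    have hzneg : ∀ i, inner ℝ (a i) x = b i → inner ℝ (a i) (-z) = 0 := fun i hi => by
      rw [inner_neg_right, hz i hi, neg_zero]
    rcases lt_trichotomy (inner ℝ c z) 0 with h | h | h
    · have h' : 0 < inner ℝ c (-z) := by rw [inner_neg_right]; linarith
      exact ⟨-z, hzneg, h'.le, key _ h'⟩
    · have : ∃ i, inner ℝ (a i) z ≠ 0 := by
        by_contra! h0
        exact hz0 (hp.eq_zero h0)
      obtain ⟨i, hi⟩ := this
      rcases hi.lt_or_gt with hi | hi
      · exact ⟨-z, hzneg, by rw [inner_neg_right, h, neg_zero], i, by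
          rw [inner_neg_right]; linarith⟩
      · exact ⟨z, hz, h.ge, i, hi⟩
    · exact ⟨z, hz, h.le, key z h⟩
  clear hz hz0
  obtain ⟨z, hz, hcz, i₁, hi₁⟩ := hpos
  obtain ⟨i₀, hi₀, hmin⟩ := Finset.exists_min_image
    (Finset.univ.filter fun i => 0 < inner ℝ (a i) z)
    (fun i => (b i - inner ℝ (a i) x) / inner ℝ (a i) z) ⟨i₁, by simpa using hi₁⟩
  simp only [Finset.mem_filter, Finset.mem_univ, true_and] at hi₀ hmin
  set t := (b i₀ - inner ℝ (a i₀) x) / inner ℝ (a i₀) z with ht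
  have ht0 : 0 ≤ t := div_nonneg (by linarith [hx i₀]) hi₀.le
  have hinner : ∀ i, inner ℝ (a i) (x + t • z) = inner ℝ (a i) x + t * inner ℝ (a i) z := by
    intro i; rw [inner_add_right, inner_smul_right]
  have hx' : x + t • z ∈ polyhedron a b := fun i => by
    rw [hinner]
    rcases le_or_gt (inner ℝ (a i) z) 0 with h | h
    · have := mul_nonpos_of_nonneg_of_nonpos ht0 h
      linarith [hx i]
    · have := hmin i h
      rw [le_div_iff₀ h] at this
      linarith
  have htight : inner ℝ (a i₀) (x + t • z) = b i₀ := by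
    rw [hinner, ht, div_mul_cancel₀ _ hi₀.ne']; ring
  obtain ⟨v, hv, hle⟩ := ih _ (by
    rw [← hk]
    refine Finset.card_lt_card (Finset.ssubset_iff_of_subset ?_ |>.2 ⟨i₀, ?_, ?_⟩)
    · intro i hi
      simp only [Finset.mem_filter, Finset.mem_univ, true_and] at hi ⊢
      intro h
      apply hi
      rw [hinner, h, hz i h, mul_zero, add_zero]
    · simp only [Finset.mem_filter, Finset.mem_univ, true_and]
      intro h
      exact hi₀.ne' (hz i₀ h)
    · simpa using htight) hx' rfl
  refine ⟨v, hv, le_trans ?_ hle⟩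
  rw [inner_add_right, inner_smul_right]
  nlinarith

lemma exists_mem_optimalFace (hp : IsPointedSystem a) (hne : (polyhedron a b).Nonempty)
    {c : EuclideanSpace ℝ (Fin n)} {M : ℝ} (hM : ∀ y ∈ polyhedron a b, inner ℝ c y ≤ M) :
    ∃ v ∈ (polyhedron a b).extremePoints ℝ, v ∈ optimalFace (polyhedron a b) c := by
  obtain ⟨x, hx⟩ := hne
  obtain ⟨v₀, hv₀, -⟩ := exists_extremePoint_inner_ge hp hM hx
  obtain ⟨v, hv, hmax⟩ := Set.exists_max_image _ (fun v => inner ℝ c v)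
    (finite_extremePoints_polyhedron (a := a) (b := b)) ⟨v₀, hv₀⟩
  refine ⟨v, hv, hv.1, fun y hy => ?_⟩
  obtain ⟨w, hw, hyw⟩ := exists_extremePoint_inner_ge hp hM hy
  exact hyw.trans (hmax w hw)

lemma nonneg_combination_of_mem_hull {s : Set (EuclideanSpace ℝ (Fin n))}
    {z c : EuclideanSpace ℝ (Fin n)} (hz : ∀ y ∈ s, inner ℝ y z ≤ 0)
    (hc : c ∈ PointedCone.hull ℝ s) : inner ℝ c z ≤ 0 := by
  induction hc using Submodule.span_induction with
  | mem x hx => exact hz x hx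
  | zero => simp
  | add x y _ _ hx hy => rw [inner_add_left]; linarith
  | smul r x _ hx =>
    have : r • x = (r : ℝ) • x := rfl
    rw [this, inner_smul_left]
    exact mul_nonpos_of_nonneg_of_nonpos r.2 hx

lemma inner_lt_of_mem_interior_polyhedron {x : EuclideanSpace ℝ (Fin n)}
    (hx : x ∈ interior (polyhedron a b)) {i : Fin m} (hi : a i ≠ 0) : inner ℝ (a i) x < b i := by
  obtain ⟨ε, hε, hball⟩ := Metric.mem_nhds_iff.1 (mem_interior_iff_mem_nhds.1 hx)
  have hn : 0 < ‖a i‖ := norm_pos_iff.2 hi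
  have h := hball (show x + (ε / (2 * ‖a i‖)) • a i ∈ Metric.ball x ε by
    rw [mem_ball_iff_norm, add_sub_cancel_left, norm_smul, Real.norm_of_nonneg (by positivity)]
    field_simp
    linarith) i
  rw [inner_add_right, inner_smul_right, real_inner_self_eq_norm_sq] at h
  have : 0 < ε / (2 * ‖a i‖) * ‖a i‖ ^ 2 := by positivity
  linarith

/-- **Farkas' lemma**: the normal cone at a point of a full-dimensional polyhedron consists of the
objectives that are maximized there. -/
lemma mem_normalCone_iff (hfull : (interior (polyhedron a b)).Nonempty)
    {v : EuclideanSpace ℝ (Fin n)} (hv : v ∈ polyhedron a b) {c : EuclideanSpace ℝ (Fin n)} :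
    c ∈ normalCone a b v ↔ v ∈ optimalFace (polyhedron a b) c := by
  set S := a '' {i | inner ℝ (a i) v = b i} with hS
  have hdef : c ∈ normalCone a b v ↔ c ∈ PointedCone.hull ℝ S := Iff.rfl
  rw [hdef]
  constructor
  · refine fun hc => ⟨hv, fun y hy => ?_⟩
    have := nonneg_combination_of_mem_hull (z := y - v) (c := c) (s := S) (by
      rintro _ ⟨i, hi, rfl⟩
      rw [inner_sub_right, show inner ℝ (a i) v = b i from hi]
      linarith [hy i]) hc
    rw [inner_sub_right] at this
    linarith
  · intro hopt
    by_contra hc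
    obtain ⟨x₀, hx₀⟩ := hfull
    have hS0 : ∀ y ∈ S, y ≠ 0 → inner ℝ y (x₀ - v) < 0 := by
      rintro _ ⟨i, hi, rfl⟩ h0
      rw [inner_sub_right, show inner ℝ (a i) v = b i from hi]
      linarith [inner_lt_of_mem_interior_polyhedron hx₀ h0]
    have hS1 : ∀ k ∈ PointedCone.hull ℝ S, inner ℝ k (x₀ - v) ≤ 0 := fun k hk =>
      nonneg_combination_of_mem_hull (fun y hy => by
        by_cases h0 : y = 0
        · simp [h0]
        · exact (hS0 y hy h0).le) hk
    let T : Set (EuclideanSpace ℝ (Fin n)) := {y | ∃ t : ℝ, 0 ≤ t ∧ ∃ k ∈ PointedCone.hull ℝ S,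
      y = k - t • c ∧ (0 < t ∨ inner ℝ k (x₀ - v) < 0)}
    have hT : Convex ℝ T := by
      rw [convex_iff_forall_pos]
      rintro _ ⟨t, ht, k, hk, rfl, h⟩ _ ⟨t', ht', k', hk', rfl, h'⟩ α β hα hβ -
      have hmem : ∀ {r : ℝ}, 0 < r → ∀ {k}, k ∈ PointedCone.hull ℝ S →
          r • k ∈ PointedCone.hull ℝ S := fun {r} hr {k} hk =>
        (PointedCone.hull ℝ S).smul_mem hr.le hk
      refine ⟨α * t + β * t', by positivity, α • k + β • k',
        (PointedCone.hull ℝ S).add_mem (hmem hα hk) (hmem hβ hk'), by module, ?_⟩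
      have e1 := hS1 k hk
      have e2 := hS1 k' hk'
      rcases h with h | h
      · left; positivity
      rcases h' with h' | h'
      · left; positivity
      right
      rw [inner_add_left, inner_smul_left, inner_smul_left]
      exact add_neg (mul_neg_of_pos_of_neg hα h) (mul_neg_of_pos_of_neg hβ h')
    set K := convexHull ℝ (insert (-c) (S \ {0})) with hK
    have hKT : K ⊆ T := by
      refine convexHull_min (Set.insert_subset ?_ ?_) hT
      · exact ⟨1, zero_le_one, 0, Submodule.zero_mem _, by simp, Or.inl one_pos⟩
      · rintro y ⟨hy, hy0⟩
        exact ⟨0, le_rfl, y, PointedCone.subset_hull hy, by simp, Or.inr (hS0 y hy (by simpa using hy0))⟩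
    have h0K : (0 : EuclideanSpace ℝ (Fin n)) ∉ K := by
      intro h0
      obtain ⟨t, ht, k, hk, hkt, h⟩ := hKT h0
      have hkt' : k = t • c := (sub_eq_zero.1 hkt.symm)
      rcases h with h | h
      · apply hc
        have : c = t⁻¹ • k := by rw [hkt', smul_smul, inv_mul_cancel₀ h.ne', one_smul]
        rw [this]
        exact (PointedCone.hull ℝ S).smul_mem (by positivity) hk
      · rcases ht.eq_or_lt with h' | h'
        · rw [← h', zero_smul] at hkt'
          simp [hkt'] at h
        · apply hc
          have : c = t⁻¹ • k := by rw [hkt', smul_smul, inv_mul_cancel₀ h'.ne', one_smul]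
          rw [this]
          exact (PointedCone.hull ℝ S).smul_mem (by positivity) hk
    have hfin : (insert (-c) (S \ {0})).Finite :=
      (((Set.toFinite _).image a).sdiff).insert _
    obtain ⟨f, u, hu0, huK⟩ := geometric_hahn_banach_point_closed (convex_convexHull ℝ _)
      (hfin.isClosed_convexHull ℝ) h0K
    rw [map_zero] at hu0
    set z := -(InnerProductSpace.toDual ℝ _).symm f with hz
    have hfz : ∀ y, inner ℝ y z = - f y := fun y => by
      rw [hz, inner_neg_right, real_inner_comm, InnerProductSpace.toDual_symm_apply]
    have hcz : 0 < inner ℝ c z := by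
      have := huK (-c) (subset_convexHull ℝ _ (Set.mem_insert _ _))
      rw [map_neg] at this
      rw [hfz]; linarith
    have haz : ∀ i, inner ℝ (a i) v = b i → inner ℝ (a i) z ≤ 0 := by
      intro i hi
      by_cases h0 : a i = 0
      · simp [h0]
      · have := huK (a i) (subset_convexHull ℝ _ (Set.mem_insert_of_mem _ ⟨⟨i, hi, rfl⟩, h0⟩))
        rw [hfz]; linarith
    have hev : ∀ᶠ t : ℝ in nhdsWithin 0 (Set.Ioi 0), v + t • z ∈ polyhedron a b := by
      simp only [polyhedron, Set.mem_ofPred_eq]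
      refine Filter.eventually_all.2 fun i => ?_
      rcases (hv i).eq_or_lt with h | h
      · filter_upwards [self_mem_nhdsWithin] with t ht
        rw [inner_add_right, inner_smul_right, h]
        linarith [mul_nonpos_of_nonneg_of_nonpos (le_of_lt ht) (haz i h)]
      · have hcont : Continuous fun t : ℝ => inner ℝ (a i) (v + t • z) := by fun_prop
        exact (((hcont.tendsto 0).eventually_lt_const (by simpa using h)).mono
          fun t ht => ht.le).filter_mono nhdsWithin_le_nhds
    obtain ⟨t, htP, ht⟩ := (hev.and self_mem_nhdsWithin).exists
    have := hopt.2 _ htP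
    rw [inner_add_right, inner_smul_right] at this
    have : 0 < t * inner ℝ c z := mul_pos ht hcz
    linarith

end Polyhedron

section UpperEnvelope

variable {V : Type*} [Fintype V]

/-- The line `r ↦ α u + r * β u` attains the upper envelope of all lines at `r`. -/
def OnEnvelope (α β : V → ℝ) (r : ℝ) (u : V) : Prop :=
  ∀ w, α w + r * β w ≤ α u + r * β u

/-- The walk along the upper envelope of a family of lines from parameter `s` to `1`. -/
lemma exists_envelope_walk (G : SimpleGraph V) {α β : V → ℝ}
    (htriple : ∀ r ∈ Set.Icc (0 : ℝ) 1, ∀ u v w, OnEnvelope α β r u → OnEnvelope α β r v →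
      OnEnvelope α β r w → u = v ∨ u = w ∨ v = w)
    (hadj : ∀ r ∈ Set.Icc (0 : ℝ) 1, ∀ u v, OnEnvelope α β r u → OnEnvelope α β r v → u ≠ v →
      G.Adj u v)
    {z : V} (hz : OnEnvelope α β 1 z) (hend : ∀ u, OnEnvelope α β 1 u → u = z)
    {s : ℝ} (hs0 : 0 ≤ s) (hs1 : s < 1) {v : V} (hv : OnEnvelope α β s v)
    (hstart : ∀ u, u ≠ v → OnEnvelope α β s u → β u < β v) :
    ∃ (p : G.Walk v z) (t : ℕ → ℝ), t 0 = s ∧ t (p.length + 1) = 1 ∧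
      (∀ i ≤ p.length, t i < t (i + 1) ∧ ∀ r ∈ Set.Ioo (t i) (t (i + 1)), 0 ≤ r ∧ r ≤ 1 ∧
        ∀ u, OnEnvelope α β r u ↔ u = p.getVert i) ∧
      (∀ i < p.length, 0 ≤ t (i + 1) ∧ t (i + 1) ≤ 1 ∧
        ∀ u, OnEnvelope α β (t (i + 1)) u ↔ u = p.getVert i ∨ u = p.getVert (i + 1)) ∧
      p.length = {u | β v < β u ∧ ∃ r ∈ Set.Icc s 1, OnEnvelope α β r u}.ncard := by
  classical
  induction hk : {u | β v < β u}.ncard using Nat.strong_induction_on generalizing s v with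
  | _ k ih =>
  set ρ : V → ℝ := fun w => (α v - α w) / (β w - β v) with hρ
  have hle : ∀ w, β v < β w → ∀ r, α w + r * β w ≤ α v + r * β v ↔ r ≤ ρ w := fun w hw r => by
    rw [hρ, le_div_iff₀ (by linarith)]
    constructor <;> intro h <;> linarith
  have hge : ∀ w, β v < β w → ∀ r, α v + r * β v ≤ α w + r * β w ↔ ρ w ≤ r := fun w hw r => by
    rw [hρ, div_le_iff₀ (by linarith)]
    constructor <;> intro h <;> linarith
  have hsρ : ∀ w, β v < β w → s < ρ w := fun w hw => by
    refine lt_of_le_of_ne ((hle w hw s).1 (hv w)) fun h => ?_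
    have : OnEnvelope α β s w := fun u => (hv u).trans ((hge w hw s).2 h.ge)
    have := hstart w (fun h => by simp [h] at hw) this
    linarith
  have hlow : ∀ u, u ≠ v → β u ≤ β v → ∀ r, s < r → α u + r * β u < α v + r * β v := by
    intro u huv hu r hr
    have h1 := hv u
    rcases hu.lt_or_eq with h | h
    · nlinarith
    · rcases h1.lt_or_eq with h2 | h2
      · rw [h] at h2 ⊢; linarith
      · have : OnEnvelope α β s u := fun w => (hv w).trans h2.ge
        have := hstart u huv this
        linarith
  have hopt : ∀ r, s < r → (∀ w, β v < β w → r ≤ ρ w) → OnEnvelope α β r v := by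
    intro r hr h w
    rcases le_or_gt (β w) (β v) with hw | hw
    · by_cases hwv : w = v
      · rw [hwv]
      · exact (hlow w hwv hw r hr).le
    · exact (hle w hw r).2 (h w hw)
  have huniq : ∀ r, s < r → (∀ w, β v < β w → r < ρ w) → ∀ u, OnEnvelope α β r u ↔ u = v := by
    intro r hr h u
    refine ⟨fun hu => ?_, fun hu => hu ▸ hopt r hr fun w hw => (h w hw).le⟩
    by_contra huv
    rcases le_or_gt (β u) (β v) with hw | hw
    · exact absurd (hu v) (not_le.2 (hlow u huv hw r hr))
    · exact absurd ((hge u hw r).1 (hu v)) (not_le.2 (h u hw))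
  by_cases hcase : ∀ w, β v < β w → 1 ≤ ρ w
  · have hvz : v = z := hend v (hopt 1 hs1 hcase)
    subst hvz
    refine ⟨SimpleGraph.Walk.nil, fun i => if i = 0 then s else 1, by simp, by simp, ?_,
      by simp, ?_⟩
    · intro i hi
      have hi0 : i = 0 := by simpa using hi
      subst hi0
      refine ⟨by simpa using hs1, fun r hr => ?_⟩
      simp only [if_true, Set.mem_Ioo] at hr
      have hr1 : r < 1 := by simpa using hr.2
      exact ⟨by linarith [hr.1], hr1.le,
        huniq r hr.1 fun w hw => hr1.trans_le (hcase w hw)⟩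
    · symm
      rw [SimpleGraph.Walk.length_nil, Set.ncard_eq_zero, Set.eq_empty_iff_forall_notMem]
      rintro u ⟨hu, r, hr, hur⟩
      have h1 := (hge u hu r).1 (hur v)
      have h2 := hcase u hu
      have h3 : r = 1 := le_antisymm hr.2 (h2.trans h1)
      subst h3
      rw [hend u hur] at hu
      exact lt_irrefl _ hu
  · push Not at hcase
    obtain ⟨w₀, hw₀, hw₀1⟩ := hcase
    obtain ⟨w, hw, hmin⟩ := Finset.exists_min_image (Finset.univ.filter fun w => β v < β w) ρ
      ⟨w₀, by simpa using hw₀⟩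
    simp only [Finset.mem_filter, Finset.mem_univ, true_and] at hw hmin
    have hs' : s < ρ w := hsρ w hw
    have hs'1 : ρ w < 1 := (hmin w₀ hw₀).trans_lt hw₀1
    have hIcc : ρ w ∈ Set.Icc (0 : ℝ) 1 := ⟨hs0.trans hs'.le, hs'1.le⟩
    have hvopt : OnEnvelope α β (ρ w) v := hopt _ hs' hmin
    have hwopt : OnEnvelope α β (ρ w) w := fun u =>
      (hvopt u).trans ((hge w hw _).2 le_rfl)
    have hvw : v ≠ w := fun h => by simp [h] at hw
    have htie : ∀ u, OnEnvelope α β (ρ w) u ↔ u = v ∨ u = w := by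
      refine fun u => ⟨fun hu => ?_, fun hu => ?_⟩
      · rcases htriple _ hIcc u v w hu hvopt hwopt with h | h | h
        · exact Or.inl h
        · exact Or.inr h
        · exact absurd h hvw
      · rcases hu with h | h
        · exact h ▸ hvopt
        · exact h ▸ hwopt
    obtain ⟨p, t, ht0, ht1, hint, hbreak, hlen⟩ := ih _ (by
        rw [← hk]
        refine Set.ncard_lt_ncard ((Set.ssubset_iff_of_subset ?_).2 ⟨w, hw, ?_⟩) (Set.toFinite _)
        · exact fun u hu => lt_trans hw hu
        · exact lt_irrefl (β w)) hIcc.1 hs'1 hwopt (fun u huw hu => by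
          rcases (htie u).1 hu with h | h
          · rw [h]; exact hw
          · exact absurd h huw) rfl
    refine ⟨SimpleGraph.Walk.cons (hadj _ hIcc v w hvopt hwopt hvw) p,
      fun i => Nat.casesOn i s t, rfl, by simpa using ht1, ?_, ?_, ?_⟩
    · rintro (_ | i) hi
      · simp only [ht0, SimpleGraph.Walk.getVert_zero]
        refine ⟨hs', fun r hr => ?_⟩
        have hr1 : s < r := hr.1
        have hr2 : r < ρ w := hr.2
        exact ⟨by linarith, by linarith, huniq r hr1 fun u hu => hr2.trans_le (hmin u hu)⟩
      · simpa using hint i (by simpa using hi)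
    · rintro (_ | i) hi
      · simp only [ht0, SimpleGraph.Walk.getVert_zero, SimpleGraph.Walk.getVert_cons_succ]
        exact ⟨hIcc.1, hIcc.2, htie⟩
      · simpa using hbreak i (by simpa using hi)
    · rw [SimpleGraph.Walk.length_cons, hlen]
      rw [← Set.ncard_insert_of_notMem (a := w) (by simp) (Set.toFinite _)]
      congr 1
      ext u
      constructor
      · rintro (rfl | ⟨hu, r, hr, hur⟩)
        · exact ⟨hw, _, ⟨hs'.le, hs'1.le⟩, hwopt⟩
        · exact ⟨hw.trans hu, r, ⟨hs'.le.trans hr.1, hr.2⟩, hur⟩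
      · rintro ⟨hu, r, hr, hur⟩
        by_cases huw : u = w
        · exact Or.inl huw
        right
        have h1 : ρ w ≤ r := (hmin u hu).trans ((hge u hu r).1 (hur v))
        refine ⟨?_, r, ⟨h1, hr.2⟩, hur⟩
        have h2 : α u + ρ w * β u < α w + ρ w * β w := by
          refine lt_of_le_of_ne (hwopt u) fun h => ?_
          have : OnEnvelope α β (ρ w) u := fun x => (hwopt x).trans h.ge
          rcases (htie u).1 this with h' | h'
          · rw [h'] at hu; exact lt_irrefl _ hu
          · exact huw h'
        have h3 := hur w
        by_contra h4
        push Not at h4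
        nlinarith

/-- The walk along the whole upper envelope; its length is the number of lines that contribute to
the envelope, minus one. -/
lemma exists_envelope_walk_zero_one (G : SimpleGraph V) {α β : V → ℝ}
    (htriple : ∀ r ∈ Set.Icc (0 : ℝ) 1, ∀ u v w, OnEnvelope α β r u → OnEnvelope α β r v →
      OnEnvelope α β r w → u = v ∨ u = w ∨ v = w)
    (hadj : ∀ r ∈ Set.Icc (0 : ℝ) 1, ∀ u v, OnEnvelope α β r u → OnEnvelope α β r v → u ≠ v →
      G.Adj u v)
    {v z : V} (hv : ∀ u, OnEnvelope α β 0 u ↔ u = v) (hz : ∀ u, OnEnvelope α β 1 u ↔ u = z) :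
    ∃ (p : G.Walk v z) (t : ℕ → ℝ), t 0 = 0 ∧ t (p.length + 1) = 1 ∧
      (∀ i ≤ p.length, t i < t (i + 1) ∧ ∀ r ∈ Set.Ioo (t i) (t (i + 1)), 0 ≤ r ∧ r ≤ 1 ∧
        ∀ u, OnEnvelope α β r u ↔ u = p.getVert i) ∧
      (∀ i < p.length, 0 ≤ t (i + 1) ∧ t (i + 1) ≤ 1 ∧
        ∀ u, OnEnvelope α β (t (i + 1)) u ↔ u = p.getVert i ∨ u = p.getVert (i + 1)) ∧
      p.length + 1 = {u | ∃ r ∈ Set.Icc (0 : ℝ) 1, OnEnvelope α β r u}.ncard := by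
  classical
  obtain ⟨p, t, h1, h2, h3, h4, h5⟩ := exists_envelope_walk G htriple hadj ((hz z).2 rfl)
    (fun u hu => (hz u).1 hu) le_rfl one_pos ((hv v).2 rfl)
    (fun u hu h => absurd ((hv u).1 h) hu)
  refine ⟨p, t, h1, h2, h3, h4, ?_⟩
  rw [h5, ← Set.ncard_insert_of_notMem (a := v) (by simp) (Set.toFinite _)]
  congr 1
  ext u
  constructor
  · rintro (rfl | ⟨-, h⟩)
    · exact ⟨0, ⟨le_rfl, zero_le_one⟩, (hv u).2 rfl⟩
    · exact h
  · rintro ⟨r, hr, hur⟩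
    by_cases huv : u = v
    · exact Or.inl huv
    refine Or.inr ⟨?_, r, hr, hur⟩
    have h6 : α u + 0 * β u < α v + 0 * β v := by
      refine lt_of_le_of_ne ((hv v).2 rfl u) fun h => huv ((hv u).1 fun w => ?_)
      exact ((hv v).2 rfl w).trans h.ge
    have h7 := hur v
    by_contra h8
    push Not at h8
    nlinarith [hr.1]

end UpperEnvelope

section NormalFan

variable {m n : ℕ} {a : Fin m → EuclideanSpace ℝ (Fin n)} {b : Fin m → ℝ}

lemma isExtreme_optimalFace {P : Set (EuclideanSpace ℝ (Fin n))} (c : EuclideanSpace ℝ (Fin n)) :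
    IsExtreme ℝ P (optimalFace P c) :=
  IsExposed.isExtreme fun _ => ⟨innerSL ℝ c, by simp [optimalFace]⟩

lemma add_mem_normalCone {v x y : EuclideanSpace ℝ (Fin n)} (hx : x ∈ normalCone a b v)
    (hy : y ∈ normalCone a b v) : x + y ∈ normalCone a b v :=
  Submodule.add_mem _ hx hy

lemma smul_mem_normalCone {v x : EuclideanSpace ℝ (Fin n)} {r : ℝ} (hr : 0 ≤ r)
    (hx : x ∈ normalCone a b v) : r • x ∈ normalCone a b v :=
  PointedCone.smul_mem _ hr hx

lemma isClosed_normalCone (hfull : (interior (polyhedron a b)).Nonempty)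
    {v : EuclideanSpace ℝ (Fin n)} (hv : v ∈ polyhedron a b) : IsClosed (normalCone a b v) := by
  have : normalCone a b v = ⋂ y ∈ polyhedron a b, {c | inner ℝ c y ≤ inner ℝ c v} := by
    ext c
    simp [mem_normalCone_iff hfull hv, optimalFace, hv]
  rw [this]
  exact isClosed_biInter fun y _ => isClosed_le (by fun_prop) (by fun_prop)

lemma mem_fanSupport_iff {c : EuclideanSpace ℝ (Fin n)} :
    c ∈ fanSupport a b ↔ ∃ v ∈ (polyhedron a b).extremePoints ℝ, c ∈ normalCone a b v := by
  simp [fanSupport]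

lemma normalCone_subset_fanSupport {v : EuclideanSpace ℝ (Fin n)}
    (hv : v ∈ (polyhedron a b).extremePoints ℝ) : normalCone a b v ⊆ fanSupport a b :=
  fun _ hc => mem_fanSupport_iff.2 ⟨v, hv, hc⟩

/-- The support of the normal fan consists of the objectives that are bounded on the polyhedron. -/
lemma mem_fanSupport_of_bounded (hp : IsPointedSystem a)
    (hfull : (interior (polyhedron a b)).Nonempty) {c : EuclideanSpace ℝ (Fin n)} {M : ℝ}
    (hM : ∀ y ∈ polyhedron a b, inner ℝ c y ≤ M) : c ∈ fanSupport a b := by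
  obtain ⟨v, hv, hvc⟩ := exists_mem_optimalFace hp (hfull.mono interior_subset) hM
  exact mem_fanSupport_iff.2 ⟨v, hv, (mem_normalCone_iff hfull hv.1).2 hvc⟩

lemma add_mem_fanSupport (hp : IsPointedSystem a) (hfull : (interior (polyhedron a b)).Nonempty)
    {x y : EuclideanSpace ℝ (Fin n)} (hx : x ∈ fanSupport a b) (hy : y ∈ fanSupport a b) :
    x + y ∈ fanSupport a b := by
  obtain ⟨v, hv, hvx⟩ := mem_fanSupport_iff.1 hx
  obtain ⟨w, hw, hwy⟩ := mem_fanSupport_iff.1 hy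
  refine mem_fanSupport_of_bounded hp hfull (M := inner ℝ x v + inner ℝ y w) fun z hz => ?_
  rw [inner_add_left]
  exact add_le_add (((mem_normalCone_iff hfull hv.1).1 hvx).2 z hz)
    (((mem_normalCone_iff hfull hw.1).1 hwy).2 z hz)

lemma smul_mem_fanSupport {x : EuclideanSpace ℝ (Fin n)} {r : ℝ} (hr : 0 ≤ r)
    (hx : x ∈ fanSupport a b) : r • x ∈ fanSupport a b := by
  obtain ⟨v, hv, hvx⟩ := mem_fanSupport_iff.1 hx
  exact mem_fanSupport_iff.2 ⟨v, hv, smul_mem_normalCone hr hvx⟩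

lemma isClosed_fanSupport (hfull : (interior (polyhedron a b)).Nonempty) :
    IsClosed (fanSupport a b) :=
  finite_extremePoints_polyhedron.isClosed_biUnion fun _ hv => isClosed_normalCone hfull hv.1

lemma add_mem_interior_fanSupport (hp : IsPointedSystem a)
    (hfull : (interior (polyhedron a b)).Nonempty) {c x : EuclideanSpace ℝ (Fin n)}
    (hc : c ∈ interior (fanSupport a b)) (hx : x ∈ fanSupport a b) :
    c + x ∈ interior (fanSupport a b) := by
  have hopen : IsOpen ((fun y => y + x) '' interior (fanSupport a b)) :=
    isOpenMap_add_right x _ isOpen_interior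
  refine interior_maximal ?_ hopen ⟨c, hc, rfl⟩
  rintro _ ⟨y, hy, rfl⟩
  exact add_mem_fanSupport hp hfull (interior_subset hy) hx

lemma convex_fanSupport (hp : IsPointedSystem a) (hfull : (interior (polyhedron a b)).Nonempty) :
    Convex ℝ (fanSupport a b) := fun _ hx _ hy _ _ hs ht _ =>
  add_mem_fanSupport hp hfull (smul_mem_fanSupport hs hx) (smul_mem_fanSupport ht hy)

lemma isClosed_optimalFace (c : EuclideanSpace ℝ (Fin n)) :
    IsClosed (optimalFace (polyhedron a b) c) := by
  have : optimalFace (polyhedron a b) c =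
      polyhedron a b ∩ ⋂ y ∈ polyhedron a b, {x | inner ℝ c y ≤ inner ℝ c x} := by
    ext x; simp [optimalFace]
  rw [this]
  exact isClosed_polyhedron.inter
    (isClosed_biInter fun y _ => isClosed_le continuous_const (by fun_prop))

lemma isCompact_optimalFace {c : EuclideanSpace ℝ (Fin n)}
    (hfull : (interior (polyhedron a b)).Nonempty) (hc : c ∈ interior (fanSupport a b)) :
    IsCompact (optimalFace (polyhedron a b) c) := by
  obtain ⟨R, hR⟩ := (finite_extremePoints_polyhedron (a := a) (b := b)).isBounded.exists_norm_le
  obtain ⟨ε, hε, hball⟩ := Metric.mem_nhds_iff.1 (mem_interior_iff_mem_nhds.1 hc)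
  refine Metric.isCompact_of_isClosed_isBounded (isClosed_optimalFace c)
    (isBounded_iff_forall_norm_le.2 ⟨max R 0, fun y hy => ?_⟩)
  by_cases hy0 : y = 0
  · simp [hy0]
  have hn : 0 < ‖y‖ := norm_pos_iff.2 hy0
  have hmem := hball (show c + (ε / (2 * ‖y‖)) • y ∈ Metric.ball c ε by
    rw [mem_ball_iff_norm, add_sub_cancel_left, norm_smul, Real.norm_of_nonneg (by positivity)]
    field_simp
    linarith)
  obtain ⟨v, hv, hvn⟩ := mem_fanSupport_iff.1 hmem
  have h1 := ((mem_normalCone_iff hfull hv.1).1 hvn).2 y hy.1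
  have h2 := hy.2 v hv.1
  have h3 := real_inner_le_norm y v
  rw [inner_add_left, inner_add_left, inner_smul_left, inner_smul_left,
    real_inner_self_eq_norm_sq] at h1
  have hpos : 0 < ε / (2 * ‖y‖) := by positivity
  simp only [conj_trivial] at h1
  have h4 : ‖y‖ ^ 2 ≤ inner ℝ y v := le_of_mul_le_mul_left (by linarith) hpos
  have h5 : ‖y‖ * ‖y‖ ≤ ‖y‖ * ‖v‖ := by nlinarith
  exact ((le_of_mul_le_mul_left h5 hn).trans (hR v hv)).trans (le_max_left _ _)

lemma convex_optimalFace (c : EuclideanSpace ℝ (Fin n)) :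
    Convex ℝ (optimalFace (polyhedron a b) c) := by
  intro x hx y hy s t hs ht hst
  refine ⟨convex_polyhedron hx.1 hy.1 hs ht hst, fun z hz => ?_⟩
  rw [inner_add_right, inner_smul_right, inner_smul_right]
  have h1 := mul_le_mul_of_nonneg_left (hx.2 z hz) hs
  have h2 := mul_le_mul_of_nonneg_left (hy.2 z hz) ht
  have h3 : s * inner ℝ c z + t * inner ℝ c z = inner ℝ c z := by rw [← add_mul, hst, one_mul]
  linarith

lemma optimalFace_eq_convexHull {c : EuclideanSpace ℝ (Fin n)}
    (hfull : (interior (polyhedron a b)).Nonempty) (hc : c ∈ interior (fanSupport a b)) :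
    optimalFace (polyhedron a b) c =
      convexHull ℝ ((polyhedron a b).extremePoints ℝ ∩ optimalFace (polyhedron a b) c) := by
  have h1 := closure_convexHull_extremePoints (isCompact_optimalFace hfull hc)
    (convex_optimalFace c)
  have h2 : (optimalFace (polyhedron a b) c).extremePoints ℝ =
      (polyhedron a b).extremePoints ℝ ∩ optimalFace (polyhedron a b) c := by
    rw [(isExtreme_optimalFace c).extremePoints_eq, Set.inter_comm]
  rw [h2] at h1
  rw [← IsClosed.closure_eq ((finite_extremePoints_polyhedron.subset
    Set.inter_subset_left).isClosed_convexHull ℝ), h1]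

lemma mem_optimalFace_iff_forall_extremePoints (hfull : (interior (polyhedron a b)).Nonempty)
    {c : EuclideanSpace ℝ (Fin n)} (hc : c ∈ fanSupport a b)
    (u : (polyhedron a b).extremePoints ℝ) :
    (u : EuclideanSpace ℝ (Fin n)) ∈ optimalFace (polyhedron a b) c ↔
      ∀ w : (polyhedron a b).extremePoints ℝ, inner ℝ c (w : EuclideanSpace ℝ (Fin n)) ≤
        inner ℝ c (u : EuclideanSpace ℝ (Fin n)) := by
  refine ⟨fun h w => h.2 w w.2.1, fun h => ⟨u.2.1, fun y hy => ?_⟩⟩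
  obtain ⟨v, hv, hvc⟩ := mem_fanSupport_iff.1 hc
  exact (((mem_normalCone_iff hfull hv.1).1 hvc).2 y hy).trans (h ⟨v, hv⟩)

/-- The shadow simplex path along a generic segment of objectives exists, and its number of
vertices is the number of normal cones that the segment meets. -/
lemma exists_isShadowPath (hp : IsPointedSystem a) (hfull : (interior (polyhedron a b)).Nonempty)
    {e f : EuclideanSpace ℝ (Fin n)} (he : e ∈ interior (fanSupport a b))
    (hf : f ∈ interior (fanSupport a b)) {v w : (polyhedron a b).extremePoints ℝ}
    (hv : ∀ u : (polyhedron a b).extremePoints ℝ, e ∈ normalCone a b u ↔ u = v)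
    (hw : ∀ u : (polyhedron a b).extremePoints ℝ, f ∈ normalCone a b u ↔ u = w)
    (htriple : ∀ r ∈ Set.Icc (0 : ℝ) 1, ∀ x y z : (polyhedron a b).extremePoints ℝ,
      AffineMap.lineMap e f r ∈ normalCone a b x → AffineMap.lineMap e f r ∈ normalCone a b y →
      AffineMap.lineMap e f r ∈ normalCone a b z → x = y ∨ x = z ∨ y = z) :
    ∃ p : (vertexGraph (polyhedron a b)).Walk v w, IsShadowPath (polyhedron a b) e f p ∧
      p.length + 1 = {u : (polyhedron a b).extremePoints ℝ | ∃ r ∈ Set.Icc (0 : ℝ) 1,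
        AffineMap.lineMap e f r ∈ normalCone a b u}.ncard := by
  classical
  have : Fintype ((polyhedron a b).extremePoints ℝ) :=
    finite_extremePoints_polyhedron.fintype
  set α : (polyhedron a b).extremePoints ℝ → ℝ := fun u => inner ℝ e (u : EuclideanSpace ℝ (Fin n))
  set β : (polyhedron a b).extremePoints ℝ → ℝ :=
    fun u => inner ℝ (f - e) (u : EuclideanSpace ℝ (Fin n))
  have hint : ∀ r ∈ Set.Icc (0 : ℝ) 1,
      AffineMap.lineMap e f r ∈ interior (fanSupport a b) := fun r hr =>
    (convex_fanSupport hp hfull).interior.segment_subset he hf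
      (by rw [segment_eq_image_lineMap]; exact ⟨r, hr, rfl⟩)
  have hcone : ∀ (c : EuclideanSpace ℝ (Fin n)) (u : (polyhedron a b).extremePoints ℝ),
      c ∈ normalCone a b u ↔ (u : EuclideanSpace ℝ (Fin n)) ∈ optimalFace (polyhedron a b) c :=
    fun c u => mem_normalCone_iff hfull u.2.1
  have henv : ∀ r ∈ Set.Icc (0 : ℝ) 1, ∀ u, OnEnvelope α β r u ↔
      AffineMap.lineMap e f r ∈ normalCone a b u := fun r hr u => by
    rw [hcone, mem_optimalFace_iff_forall_extremePoints hfull (interior_subset (hint r hr))]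
    simp only [OnEnvelope, α, β, AffineMap.lineMap_apply_module', inner_add_left, inner_smul_left,
      conj_trivial]
    simp only [add_comm]
  have hface : ∀ r ∈ Set.Icc (0 : ℝ) 1, optimalFace (polyhedron a b) (AffineMap.lineMap e f r) =
      convexHull ℝ (((↑) : (polyhedron a b).extremePoints ℝ → EuclideanSpace ℝ (Fin n)) ''
        {u | OnEnvelope α β r u}) := fun r hr => by
    rw [optimalFace_eq_convexHull hfull (hint r hr)]
    congr 1
    ext y
    constructor
    · rintro ⟨h1, h2⟩
      exact ⟨⟨y, h1⟩, (henv r hr _).2 ((hcone _ ⟨y, h1⟩).2 h2), rfl⟩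
    · rintro ⟨u, hu, rfl⟩
      exact ⟨u.2, (hcone _ u).1 ((henv r hr u).1 hu)⟩
  have hpair : ∀ r ∈ Set.Icc (0 : ℝ) 1, ∀ u u', (∀ x, OnEnvelope α β r x ↔ x = u ∨ x = u') →
      optimalFace (polyhedron a b) (AffineMap.lineMap e f r) =
        segment ℝ (u : EuclideanSpace ℝ (Fin n)) (u' : EuclideanSpace ℝ (Fin n)) := by
    intro r hr u u' h
    rw [hface r hr, ← convexHull_pair]
    congr 1
    have : {x | OnEnvelope α β r x} = {u, u'} := by ext x; simp [h]
    rw [this, Set.image_pair]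
  obtain ⟨p, t, h0, h1, h2, h3, h4⟩ := exists_envelope_walk_zero_one (α := α) (β := β)
    (vertexGraph (polyhedron a b)) (v := v) (z := w)
    (fun r hr x y z hx hy hz => htriple r hr x y z ((henv r hr x).1 hx) ((henv r hr y).1 hy)
      ((henv r hr z).1 hz))
    (fun r hr x y hx hy hxy => ⟨hxy, by
      rw [← hpair r hr x y fun z => ⟨fun hz => ?_, fun hz => ?_⟩]
      · exact isExtreme_optimalFace _
      · rcases htriple r hr x y z ((henv r hr x).1 hx) ((henv r hr y).1 hy)
          ((henv r hr z).1 hz) with h | h | h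
        · exact absurd h hxy
        · exact Or.inl h.symm
        · exact Or.inr h.symm
      · rcases hz with rfl | rfl
        · exact hx
        · exact hy⟩)
    (fun u => by rw [henv 0 (by simp), AffineMap.lineMap_apply_zero]; exact hv u)
    (fun u => by rw [henv 1 (by simp), AffineMap.lineMap_apply_one]; exact hw u)
  refine ⟨p, ⟨t, h0, h1, fun i hi => ⟨(h2 i hi).1, fun r hr => ?_⟩, fun i hi => ?_⟩, ?_⟩
  · obtain ⟨hr0, hr1, hu⟩ := (h2 i hi).2 r hr
    rw [hface r ⟨hr0, hr1⟩]
    have : {x | OnEnvelope α β r x} = {p.getVert i} := by ext x; simp [hu]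
    rw [this, Set.image_singleton, convexHull_singleton]
  · obtain ⟨hr0, hr1, hu⟩ := h3 i hi
    exact hpair _ ⟨hr0, hr1⟩ _ _ hu
  · rw [h4]
    congr 1
    ext u
    exact exists_congr fun r => and_congr_right fun hr => henv r hr u

/-- Three distinct extreme points impose two independent ties on an objective. -/
lemma exists_orthogonal_of_extremePoints {P : Set (EuclideanSpace ℝ (Fin n))}
    (e : EuclideanSpace ℝ (Fin n)) {u v w : EuclideanSpace ℝ (Fin n)}
    (hu : u ∈ P.extremePoints ℝ) (hv : v ∈ P.extremePoints ℝ) (hw : w ∈ P.extremePoints ℝ)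
    (huv : u ≠ v) (huw : u ≠ w) (hvw : v ≠ w) :
    ∃ z : EuclideanSpace ℝ (Fin n), z ≠ 0 ∧ inner ℝ e z = 0 ∧
      ∀ y : EuclideanSpace ℝ (Fin n), inner ℝ y u = inner ℝ y v → inner ℝ y u = inner ℝ y w →
        inner ℝ y z = 0 := by
  have hbtw : ∀ x y z : EuclideanSpace ℝ (Fin n), x ∈ P.extremePoints ℝ → y ∈ P.extremePoints ℝ →
      z ∈ P.extremePoints ℝ → x ≠ y → y ≠ z → ¬ Wbtw ℝ x y z := by
    intro x y z hx hy hz hxy hyz h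
    have : y ∈ openSegment ℝ x z :=
      mem_openSegment_of_ne_left_right hxy hyz.symm (by rwa [mem_segment_iff_wbtw])
    exact hxy (hy.2 hx.1 hz.1 this)
  have hcol : ¬ Collinear ℝ {u, v, w} := by
    intro h
    rcases h.wbtw_or_wbtw_or_wbtw with h | h | h
    · exact hbtw _ _ _ hu hv hw huv hvw h
    · exact hbtw _ _ _ hv hw hu hvw huw.symm h
    · exact hbtw _ _ _ hw hu hv huw.symm huv h
  by_cases h0 : inner ℝ e (u - v) = 0
  · exact ⟨u - v, sub_ne_zero.2 huv, h0, fun y h1 _ => by rw [inner_sub_right, h1, sub_self]⟩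
  refine ⟨inner ℝ e (u - w) • (u - v) - inner ℝ e (u - v) • (u - w), fun hz => hcol ?_, ?_, ?_⟩
  · rw [collinear_iff_of_mem (p₀ := u) (by simp)]
    refine ⟨u - v, ?_⟩
    have hw' : u - w = (inner ℝ e (u - w) / inner ℝ e (u - v)) • (u - v) := by
      rw [div_eq_inv_mul, mul_smul, sub_eq_zero.1 hz, smul_smul, inv_mul_cancel₀ h0, one_smul]
    rintro p (rfl | rfl | rfl)
    · exact ⟨0, by simp⟩
    · exact ⟨-1, by simp⟩
    · refine ⟨-(inner ℝ e (u - p) / inner ℝ e (u - v)), ?_⟩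
      rw [neg_smul, ← hw']
      simp
  · rw [inner_sub_right, inner_smul_right, inner_smul_right]; ring
  · intro y h1 h2
    rw [inner_sub_right, inner_smul_right, inner_smul_right, inner_sub_right y, inner_sub_right y,
      h1, sub_self, ← h2, h1, sub_self]
    ring

lemma inner_eq_of_mem_normalCone (hfull : (interior (polyhedron a b)).Nonempty)
    {u w : EuclideanSpace ℝ (Fin n)} (hu : u ∈ polyhedron a b) (hw : w ∈ polyhedron a b)
    {c : EuclideanSpace ℝ (Fin n)} (hcu : c ∈ normalCone a b u) (hcw : c ∈ normalCone a b w) :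
    inner ℝ c u = inner ℝ c w :=
  le_antisymm (((mem_normalCone_iff hfull hw).1 hcw).2 u hu)
    (((mem_normalCone_iff hfull hu).1 hcu).2 w hw)

lemma mem_normalCone_iff_eq_of_closedBall (hfull : (interior (polyhedron a b)).Nonempty)
    {v c : EuclideanSpace ℝ (Fin n)} {τ : ℝ} (hτ : 0 < τ) (hv : v ∈ polyhedron a b)
    (hc : Metric.closedBall c τ ⊆ normalCone a b v) {u : EuclideanSpace ℝ (Fin n)}
    (hu : u ∈ polyhedron a b) : c ∈ normalCone a b u ↔ u = v := by
  refine ⟨fun hcu => ?_, fun h => h ▸ hc (Metric.mem_closedBall_self hτ.le)⟩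
  by_contra huv
  have hn : 0 < ‖u - v‖ := norm_pos_iff.2 (sub_ne_zero.2 huv)
  have h1 := inner_eq_of_mem_normalCone hfull hu hv hcu (hc (Metric.mem_closedBall_self hτ.le))
  have h2 := ((mem_normalCone_iff hfull hv).1 (hc (show c + (τ / ‖u - v‖) • (u - v) ∈
    Metric.closedBall c τ by
      rw [mem_closedBall_iff_norm, add_sub_cancel_left, norm_smul,
        Real.norm_of_nonneg (by positivity), div_mul_cancel₀ _ hn.ne']))).2 u hu
  rw [inner_add_left, inner_add_left, inner_smul_left, inner_smul_left, h1] at h2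
  simp only [conj_trivial] at h2
  have h3 : τ / ‖u - v‖ * (inner ℝ (u - v) u - inner ℝ (u - v) v) ≤ 0 := by linarith
  rw [← inner_sub_right, real_inner_self_eq_norm_sq] at h3
  have : 0 < τ / ‖u - v‖ * ‖u - v‖ ^ 2 := by positivity
  linarith

end NormalFan

section GenericPath

variable {m n : ℕ} {a : Fin m → EuclideanSpace ℝ (Fin n)} {b : Fin m → ℝ}

lemma ae_inner_add_ne_zero (p : EuclideanSpace ℝ (Fin n)) {z : EuclideanSpace ℝ (Fin n)}
    (hz : z ≠ 0) : ∀ᵐ x : EuclideanSpace ℝ (Fin n), inner ℝ (x + p) z ≠ 0 := by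
  have h0 : volume (((ℝ ∙ z)ᗮ : Submodule ℝ (EuclideanSpace ℝ (Fin n))) :
      Set (EuclideanSpace ℝ (Fin n))) = 0 := by
    refine Measure.addHaar_submodule _ _ fun h => hz ?_
    have : z ∈ (ℝ ∙ z)ᗮ := h ▸ Submodule.mem_top
    rw [Submodule.mem_orthogonal_singleton_iff_inner_right] at this
    exact inner_self_eq_zero.1 this
  have h1 := measure_preimage_add_right (volume : Measure (EuclideanSpace ℝ (Fin n))) p
    (((ℝ ∙ z)ᗮ : Submodule ℝ (EuclideanSpace ℝ (Fin n))) : Set (EuclideanSpace ℝ (Fin n)))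
  rw [h0] at h1
  refine measure_mono_null (fun x hx => ?_) h1
  have hx' : inner ℝ (x + p) z = 0 := by simpa using hx
  simpa [Submodule.mem_orthogonal_singleton_iff_inner_left] using hx'

/-- Almost every translate of `p` lies in at most one normal cone. -/
lemma ae_eq_of_mem_normalCone (hfull : (interior (polyhedron a b)).Nonempty)
    (p : EuclideanSpace ℝ (Fin n)) : ∀ᵐ x : EuclideanSpace ℝ (Fin n),
      ∀ u w : (polyhedron a b).extremePoints ℝ, p + x ∈ normalCone a b u →
        p + x ∈ normalCone a b w → u = w := by
  have : Finite ((polyhedron a b).extremePoints ℝ) := finite_extremePoints_polyhedron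
  refine ae_all_iff.2 fun u => ae_all_iff.2 fun w => ?_
  by_cases huw : u = w
  · simp [huw]
  filter_upwards [ae_inner_add_ne_zero p (z := (u : EuclideanSpace ℝ (Fin n)) - w)
    (sub_ne_zero.2 fun h => huw (Subtype.ext h))] with x hx h1 h2
  refine absurd ?_ hx
  rw [add_comm, inner_sub_right, inner_eq_of_mem_normalCone hfull u.2.1 w.2.1 h1 h2, sub_self]

/-- Almost every translate of `p` avoids all triple ties up to multiples of `e`. -/
lemma ae_no_triple_tie (hfull : (interior (polyhedron a b)).Nonempty)
    (e p : EuclideanSpace ℝ (Fin n)) : ∀ᵐ x : EuclideanSpace ℝ (Fin n),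
      ∀ r s : ℝ, r ≠ 0 → ∀ u v w : (polyhedron a b).extremePoints ℝ,
        s • e + r • (x + p) ∈ normalCone a b u → s • e + r • (x + p) ∈ normalCone a b v →
        s • e + r • (x + p) ∈ normalCone a b w → u = v ∨ u = w ∨ v = w := by
  have : Finite ((polyhedron a b).extremePoints ℝ) := finite_extremePoints_polyhedron
  have key : ∀ᵐ x : EuclideanSpace ℝ (Fin n), ∀ u v w : (polyhedron a b).extremePoints ℝ,
      u ≠ v → u ≠ w → v ≠ w → ∃ z : EuclideanSpace ℝ (Fin n), inner ℝ e z = 0 ∧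
        (∀ y : EuclideanSpace ℝ (Fin n), inner ℝ y (u : EuclideanSpace ℝ (Fin n)) = inner ℝ y v →
          inner ℝ y (u : EuclideanSpace ℝ (Fin n)) = inner ℝ y w → inner ℝ y z = 0) ∧
        inner ℝ (x + p) z ≠ 0 := by
    refine ae_all_iff.2 fun u => ae_all_iff.2 fun v => ae_all_iff.2 fun w => ?_
    by_cases h : u ≠ v ∧ u ≠ w ∧ v ≠ w
    · obtain ⟨z, hz, h1, h2⟩ := exists_orthogonal_of_extremePoints e u.2 v.2 w.2
        (fun h' => h.1 (Subtype.ext h')) (fun h' => h.2.1 (Subtype.ext h'))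
        (fun h' => h.2.2 (Subtype.ext h'))
      filter_upwards [ae_inner_add_ne_zero p hz] with x hx _ _ _
      exact ⟨z, h1, h2, hx⟩
    · exact Filter.Eventually.of_forall fun x h1 h2 h3 => absurd ⟨h1, h2, h3⟩ h
  filter_upwards [key] with x hx r s hr u v w hu hv hw
  by_contra! h
  obtain ⟨z, h1, h2, h3⟩ := hx u v w h.1 h.2.1 h.2.2
  have h4 := h2 _ (inner_eq_of_mem_normalCone hfull u.2.1 v.2.1 hu hv)
    (inner_eq_of_mem_normalCone hfull u.2.1 w.2.1 hu hw)
  rw [inner_add_left, inner_smul_left, inner_smul_left, h1] at h4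
  simp only [conj_trivial, mul_zero, zero_add] at h4
  exact h3 ((mul_eq_zero.1 h4).resolve_left hr)

/-- The vertices whose normal cones are entered along the segment from `p` to `p + δ`. -/
def enteredVertices (a : Fin m → EuclideanSpace ℝ (Fin n)) (b : Fin m → ℝ)
    (p δ : EuclideanSpace ℝ (Fin n)) : Set ((polyhedron a b).extremePoints ℝ) :=
  {u | p ∉ normalCone a b u ∧ ∃ r ∈ Set.Icc (0 : ℝ) 1, p + r • δ ∈ normalCone a b u}

lemma ncard_enteredVertices_add_one {p δ : EuclideanSpace ℝ (Fin n)}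
    {v : (polyhedron a b).extremePoints ℝ}
    (hv : ∀ u : (polyhedron a b).extremePoints ℝ, p ∈ normalCone a b u ↔ u = v) :
    (enteredVertices a b p δ).ncard + 1 =
      {u : (polyhedron a b).extremePoints ℝ | ∃ r ∈ Set.Icc (0 : ℝ) 1,
        p + r • δ ∈ normalCone a b u}.ncard := by
  have : Finite ((polyhedron a b).extremePoints ℝ) := finite_extremePoints_polyhedron
  rw [← Set.ncard_insert_of_notMem (a := v) (fun h => h.1 ((hv v).2 rfl)) (Set.toFinite _)]
  congr 1
  ext u
  constructor
  · rintro (rfl | h)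
    · exact ⟨0, by simp, by simpa using (hv u).2 rfl⟩
    · exact h.2
  · intro h
    by_cases huv : u = v
    · exact Or.inl huv
    · exact Or.inr ⟨fun h' => huv ((hv u).1 h'), h⟩

/-- Almost surely the three-leg shadow simplex path exists; its length is the total number of
normal cones entered along the legs (the last one traversed backwards). -/
lemma ae_exists_threeLegShadowPath (hp : IsPointedSystem a)
    (hfull : (interior (polyhedron a b)).Nonempty) {ε : ℝ} (hε : 0 < ε)
    {v w : (polyhedron a b).extremePoints ℝ} {c d : EuclideanSpace ℝ (Fin n)}
    (hc : Metric.closedBall c ε ⊆ normalCone a b v)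
    (hd : Metric.closedBall d ε ⊆ normalCone a b w) :
    ∀ᵐ x : EuclideanSpace ℝ (Fin n), x ∈ fanSupport a b →
      ∃ p : (vertexGraph (polyhedron a b)).Walk v w,
        IsThreeLegShadowPath (polyhedron a b) c d x p ∧
        p.length = (enteredVertices a b c x).ncard + (enteredVertices a b (c + x) (d - c)).ncard +
          (enteredVertices a b d x).ncard := by
  have hint : ∀ {e : EuclideanSpace ℝ (Fin n)} {u : (polyhedron a b).extremePoints ℝ},
      Metric.closedBall e ε ⊆ normalCone a b u → e ∈ interior (fanSupport a b) := fun {e u} h =>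
    mem_interior_iff_mem_nhds.2 (Filter.mem_of_superset (Metric.closedBall_mem_nhds e hε)
      (h.trans (normalCone_subset_fanSupport u.2)))
  have hcu : ∀ u : (polyhedron a b).extremePoints ℝ, c ∈ normalCone a b u ↔ u = v := fun u => by
    rw [mem_normalCone_iff_eq_of_closedBall hfull hε v.2.1 hc u.2.1, Subtype.ext_iff]
  have hdu : ∀ u : (polyhedron a b).extremePoints ℝ, d ∈ normalCone a b u ↔ u = w := fun u => by
    rw [mem_normalCone_iff_eq_of_closedBall hfull hε w.2.1 hd u.2.1, Subtype.ext_iff]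
  filter_upwards [ae_eq_of_mem_normalCone hfull c, ae_eq_of_mem_normalCone hfull d,
    ae_no_triple_tie hfull c 0, ae_no_triple_tie hfull d 0, ae_no_triple_tie hfull (d - c) c]
    with x hcx hdx hc3 hd3 hcd3 hx
  have hcx' := add_mem_interior_fanSupport hp hfull (hint hc) hx
  have hdx' := add_mem_interior_fanSupport hp hfull (hint hd) hx
  obtain ⟨v₁, hv₁, hv₁'⟩ := mem_fanSupport_iff.1 (interior_subset hcx')
  obtain ⟨w₁, hw₁, hw₁'⟩ := mem_fanSupport_iff.1 (interior_subset hdx')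
  have hv₁u : ∀ u : (polyhedron a b).extremePoints ℝ, c + x ∈ normalCone a b u ↔ u = ⟨v₁, hv₁⟩ :=
    fun u => ⟨fun h => hcx u ⟨v₁, hv₁⟩ h hv₁', fun h => h ▸ hv₁'⟩
  have hw₁u : ∀ u : (polyhedron a b).extremePoints ℝ, d + x ∈ normalCone a b u ↔ u = ⟨w₁, hw₁⟩ :=
    fun u => ⟨fun h => hdx u ⟨w₁, hw₁⟩ h hw₁', fun h => h ▸ hw₁'⟩
  have e1 : ∀ r : ℝ, AffineMap.lineMap c (c + x) r = c + r • x := fun r => by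
    rw [AffineMap.lineMap_apply_module']; module
  have e2 : ∀ r : ℝ, AffineMap.lineMap (c + x) (d + x) r = c + x + r • (d - c) := fun r => by
    rw [AffineMap.lineMap_apply_module']; module
  have e3 : ∀ r : ℝ, AffineMap.lineMap (d + x) d r = d + (1 - r) • x := fun r => by
    rw [AffineMap.lineMap_apply_module']; module
  have triple_ray : ∀ (e : EuclideanSpace ℝ (Fin n)) (v : (polyhedron a b).extremePoints ℝ),
      (∀ u : (polyhedron a b).extremePoints ℝ, e ∈ normalCone a b u ↔ u = v) →
      (∀ r s : ℝ, r ≠ 0 → ∀ u v w : (polyhedron a b).extremePoints ℝ,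
        s • e + r • (x + 0) ∈ normalCone a b u → s • e + r • (x + 0) ∈ normalCone a b v →
        s • e + r • (x + 0) ∈ normalCone a b w → u = v ∨ u = w ∨ v = w) →
      ∀ r : ℝ, ∀ u v w : (polyhedron a b).extremePoints ℝ, e + r • x ∈ normalCone a b u →
        e + r • x ∈ normalCone a b v → e + r • x ∈ normalCone a b w → u = v ∨ u = w ∨ v = w := by
    intro e v hv h r u₁ u₂ u₃ h1 h2 h3
    by_cases hr : r = 0
    · simp only [hr, zero_smul, add_zero] at h1 h2
      exact Or.inl (((hv _).1 h1).trans ((hv _).1 h2).symm)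
    · have := h r 1 hr u₁ u₂ u₃
      simp only [one_smul, add_zero] at this
      exact this h1 h2 h3
  obtain ⟨p₁, hp₁, hl₁⟩ := exists_isShadowPath hp hfull (hint hc) hcx' hcu hv₁u
    (fun r _ u₁ u₂ u₃ => by rw [e1]; exact triple_ray c v hcu hc3 r u₁ u₂ u₃)
  obtain ⟨p₂, hp₂, hl₂⟩ := exists_isShadowPath hp hfull hcx' hdx' hv₁u hw₁u
    (fun r _ u₁ u₂ u₃ => by
      have := hcd3 1 r one_ne_zero u₁ u₂ u₃
      have e : r • (d - c) + (1 : ℝ) • (x + c) = c + x + r • (d - c) := by module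
      rw [e] at this
      rw [e2]; exact this)
  obtain ⟨p₃, hp₃, hl₃⟩ := exists_isShadowPath hp hfull hdx' (hint hd) hw₁u hdu
    (fun r _ u₁ u₂ u₃ => by rw [e3]; exact triple_ray d w hdu hd3 (1 - r) u₁ u₂ u₃)
  refine ⟨p₁.append (p₂.append p₃), ⟨_, _, p₁, p₂, p₃, hp₁, hp₂, hp₃, rfl⟩, ?_⟩
  have n1 := ncard_enteredVertices_add_one (δ := x) hcu
  have n2 := ncard_enteredVertices_add_one (δ := d - c) hv₁u
  have n3 := ncard_enteredVertices_add_one (δ := x) hdu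
  simp only [e1] at hl₁
  simp only [e2] at hl₂
  have hl₃' : p₃.length + 1 = {u : (polyhedron a b).extremePoints ℝ | ∃ r ∈ Set.Icc (0 : ℝ) 1,
        d + r • x ∈ normalCone a b u}.ncard := by
    rw [hl₃]
    congr 1
    ext u
    constructor
    · rintro ⟨r, hr, h⟩
      exact ⟨1 - r, ⟨by linarith [hr.2], by linarith [hr.1]⟩, by rwa [← e3]⟩
    · rintro ⟨r, hr, h⟩
      exact ⟨1 - r, ⟨by linarith [hr.2], by linarith [hr.1]⟩, by rwa [e3, sub_sub_cancel]⟩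
  rw [SimpleGraph.Walk.length_append, SimpleGraph.Walk.length_append]
  omega

end GenericPath

section ExponentialLaw

variable {n : ℕ} {S : Set (EuclideanSpace ℝ (Fin n))}

lemma integrable_exp_neg_norm (hn : n ≠ 0) :
    Integrable (fun x : EuclideanSpace ℝ (Fin n) => Real.exp (-‖x‖)) := by
  have : Nonempty (Fin n) := ⟨⟨0, Nat.pos_of_ne_zero hn⟩⟩
  have h := (integrable_fun_norm_addHaar (volume : Measure (EuclideanSpace ℝ (Fin n)))
    (f := fun t : ℝ => Real.exp (-t))).2 ?_
  · exact h
  rw [finrank_euclideanSpace_fin]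
  have h := Real.GammaIntegral_convergent (s := n) (by positivity)
  refine h.congr_fun (fun t ht => ?_) measurableSet_Ioi
  simp only [smul_eq_mul]
  rw [mul_comm, show (n : ℝ) - 1 = ((n - 1 : ℕ) : ℝ) by
    rw [Nat.cast_sub (Nat.one_le_iff_ne_zero.2 hn), Nat.cast_one], Real.rpow_natCast]

lemma expDensity_nonneg (x : EuclideanSpace ℝ (Fin n)) : 0 ≤ expDensity S x :=
  Set.indicator_nonneg (fun _ _ => mul_nonneg
    (inv_nonneg.2 (integral_nonneg fun _ => (Real.exp_pos _).le)) (Real.exp_pos _).le) x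

lemma measurable_expDensity (hS : MeasurableSet S) : Measurable (expDensity S) :=
  Measurable.indicator (by fun_prop) hS

lemma integrable_expDensity (hn : n ≠ 0) (hS : MeasurableSet S) : Integrable (expDensity S) :=
  ((integrable_exp_neg_norm hn).const_mul _).indicator hS

lemma integral_expDensity (hn : n ≠ 0) (hS : MeasurableSet S) (hint : (interior S).Nonempty) :
    ∫ x, expDensity S x = 1 := by
  have hpos : 0 < ∫ y in S, Real.exp (-‖y‖) := by
    rw [setIntegral_pos_iff_support_of_nonneg_ae
      (Filter.Eventually.of_forall fun x => (Real.exp_pos _).le)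
      (integrable_exp_neg_norm hn).integrableOn]
    have : Function.support (fun y : EuclideanSpace ℝ (Fin n) => Real.exp (-‖y‖)) = Set.univ :=
      Set.eq_univ_of_forall fun x => (Real.exp_pos _).ne'
    rw [this, Set.univ_inter]
    exact (isOpen_interior.measure_pos volume hint).trans_le (measure_mono interior_subset)
  have : expDensity S = S.indicator
      (fun x => (∫ y in S, Real.exp (-‖y‖))⁻¹ * Real.exp (-‖x‖)) := rfl
  rw [this, integral_indicator hS, integral_const_mul, inv_mul_cancel₀ hpos.ne']

lemma isProbabilityMeasure_expLaw (hn : n ≠ 0) (hS : MeasurableSet S)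
    (hint : (interior S).Nonempty) : IsProbabilityMeasure (expLaw S) := by
  refine ⟨?_⟩
  rw [expLaw, withDensity_apply _ MeasurableSet.univ, Measure.restrict_univ,
    ← ofReal_integral_eq_lintegral_ofReal (integrable_expDensity hn hS)
      (Filter.Eventually.of_forall expDensity_nonneg), integral_expDensity hn hS hint,
    ENNReal.ofReal_one]

lemma expLaw_absolutelyContinuous : expLaw S ≪ volume :=
  withDensity_absolutelyContinuous _ _

lemma ae_mem_expLaw (hS : MeasurableSet S) : ∀ᵐ x ∂expLaw S, x ∈ S := by
  rw [expLaw, ae_withDensity_iff (measurable_expDensity hS).ennreal_ofReal]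
  refine Filter.Eventually.of_forall fun x hx => ?_
  by_contra h
  exact hx (by rw [expDensity, Set.indicator_of_notMem h, ENNReal.ofReal_zero])

lemma expDensity_le_exp_mul {x z : EuclideanSpace ℝ (Fin n)} {η : ℝ} (hz : ‖z‖ ≤ η)
    (hadd : x ∈ S → x + z ∈ S) :
    expDensity S x ≤ Real.exp η * expDensity S (x + z) := by
  by_cases hx : x ∈ S
  · rw [expDensity, Set.indicator_of_mem hx, expDensity, Set.indicator_of_mem (hadd hx),
      mul_left_comm, ← Real.exp_add]
    refine mul_le_mul_of_nonneg_left (Real.exp_le_exp.2 ?_)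
      (inv_nonneg.2 (integral_nonneg fun _ => (Real.exp_pos _).le))
    linarith [norm_add_le x z]
  · rw [expDensity, Set.indicator_of_notMem hx]
    exact mul_nonneg (Real.exp_pos _).le (expDensity_nonneg _)

/-- Translating by a vector of norm at most `η` that preserves `S` changes the exponential law by
a factor of at most `exp η`. -/
lemma expLaw_preimage_add_le (hS : MeasurableSet S) {z : EuclideanSpace ℝ (Fin n)} {η : ℝ}
    (hz : ‖z‖ ≤ η) (hadd : ∀ x ∈ S, x + z ∈ S) {A : Set (EuclideanSpace ℝ (Fin n))}
    (hA : MeasurableSet A) :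
    expLaw S ((fun x => x + z) ⁻¹' A) ≤ ENNReal.ofReal (Real.exp η) * expLaw S A := by
  have hmeas : Measurable fun x => ENNReal.ofReal (expDensity S x) :=
    (measurable_expDensity hS).ennreal_ofReal
  have hA' : MeasurableSet ((fun x => x + z) ⁻¹' A) := hA.preimage (by fun_prop)
  rw [expLaw, withDensity_apply _ hA', withDensity_apply _ hA, ← lintegral_indicator hA',
    ← lintegral_indicator hA]
  calc ∫⁻ x, ((fun x => x + z) ⁻¹' A).indicator (fun x => ENNReal.ofReal (expDensity S x)) x
      ≤ ∫⁻ x, ENNReal.ofReal (Real.exp η) *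
          A.indicator (fun x => ENNReal.ofReal (expDensity S x)) (x + z) := by
        refine lintegral_mono fun x => ?_
        by_cases hx : x + z ∈ A
        · rw [Set.indicator_of_mem (show x ∈ (fun x => x + z) ⁻¹' A from hx),
            Set.indicator_of_mem hx, ← ENNReal.ofReal_mul (Real.exp_pos _).le]
          exact ENNReal.ofReal_le_ofReal (expDensity_le_exp_mul hz (hadd x))
        · rw [Set.indicator_of_notMem (show x ∉ (fun x => x + z) ⁻¹' A from hx)]
          exact zero_le
    _ = ENNReal.ofReal (Real.exp η) *
          ∫⁻ x, A.indicator (fun x => ENNReal.ofReal (expDensity S x)) x := by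
        rw [lintegral_const_mul' _ _ ENNReal.ofReal_ne_top,
          lintegral_add_right_eq_self
            (A.indicator (fun x => ENNReal.ofReal (expDensity S x))) z]

lemma measureReal_expLaw_preimage_diff_le (hS : MeasurableSet S)
    [IsProbabilityMeasure (expLaw S)] {z : EuclideanSpace ℝ (Fin n)} {η : ℝ}
    (hz : ‖z‖ ≤ η) (hadd : ∀ x ∈ S, x + z ∈ S) {A : Set (EuclideanSpace ℝ (Fin n))}
    (hA : MeasurableSet A) (hAz : ∀ x ∈ A, x + z ∈ A) :
    (expLaw S).real {x | x ∉ A ∧ x + z ∈ A} ≤ (Real.exp η - 1) * (expLaw S).real A := by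
  have h1 : (expLaw S).real ((fun x => x + z) ⁻¹' A) ≤ Real.exp η * (expLaw S).real A := by
    have := ENNReal.toReal_mono (ENNReal.mul_ne_top ENNReal.ofReal_ne_top (measure_ne_top _ _))
      (expLaw_preimage_add_le hS hz hadd hA)
    rwa [ENNReal.toReal_mul, ENNReal.toReal_ofReal (Real.exp_pos _).le] at this
  have h2 : {x | x ∉ A ∧ x + z ∈ A} = ((fun x => x + z) ⁻¹' A) \ A := by
    ext x; exact and_comm
  rw [h2, measureReal_sdiff (show A ⊆ (fun x => x + z) ⁻¹' A from hAz) hA]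
  linarith

/-- A vector with the exponential distribution on a cone has norm at most `2 n` with probability
at least `1 / 2`. -/
lemma half_le_measureReal_closedBall (hn : n ≠ 0) (hS : MeasurableSet S)
    (hint : (interior S).Nonempty)
    (hcone : ∀ r : ℝ, 0 < r → ∀ x, x ∈ S → r • x ∈ S) :
    1 / 2 ≤ (expLaw S).real (Metric.closedBall 0 (2 * n)) := by
  have := isProbabilityMeasure_expLaw hn hS hint
  set B : Set (EuclideanSpace ℝ (Fin n)) := Metric.closedBall 0 (2 * n) with hB
  have hBm : MeasurableSet B := Metric.isClosed_closedBall.measurableSet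
  have hn0 : (0 : ℝ) < n := by positivity
  set f := expDensity S with hf
  set q := (expLaw S).real Bᶜ with hq
  have hqint : q = ∫ x, Bᶜ.indicator f x := by
    rw [hq, Measure.real, expLaw, withDensity_apply _ hBm.compl, integral_indicator hBm.compl,
      integral_eq_lintegral_of_nonneg_ae (Filter.Eventually.of_forall expDensity_nonneg)
      (measurable_expDensity hS).aestronglyMeasurable]
  have key : ∀ h : ℝ, 0 < h → h < 1 → 1 + h * (2 * n) * q ≤ ((1 - h) ^ n)⁻¹ := by
    intro h hh hh1
    have hs : 0 < 1 - h := by linarith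
    have hscale : ∫ x, f ((1 - h) • x) = ((1 - h) ^ n)⁻¹ := by
      rw [Measure.integral_comp_smul, finrank_euclideanSpace_fin, integral_expDensity hn hS hint,
        smul_eq_mul, mul_one, abs_of_nonneg (by positivity)]
    have hfint := integrable_expDensity hn hS
    have hsum : ∫ x, (f x + h * (2 * n) * Bᶜ.indicator f x) = 1 + h * (2 * n) * q := by
      rw [integral_add hfint ((hfint.indicator hBm.compl).const_mul _), integral_const_mul,
        ← hqint, integral_expDensity hn hS hint]
    rw [← hscale, ← hsum]
    refine integral_mono (hfint.add ((hfint.indicator hBm.compl).const_mul _))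
      (hfint.comp_smul hs.ne') fun x => ?_
    have hmem : x ∈ S ↔ (1 - h) • x ∈ S := ⟨hcone _ hs x, fun hx => by
      have := hcone _ (inv_pos.2 hs) _ hx
      rwa [smul_smul, inv_mul_cancel₀ hs.ne', one_smul] at this⟩
    by_cases hx : x ∈ S
    · have e1 : f ((1 - h) • x) = f x * Real.exp (h * ‖x‖) := by
        rw [hf, expDensity, expDensity, Set.indicator_of_mem hx,
          Set.indicator_of_mem (hmem.1 hx), mul_assoc, ← Real.exp_add, norm_smul,
          Real.norm_of_nonneg hs.le]
        congr 2
        ring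
      have e2 : h * ‖x‖ + 1 ≤ Real.exp (h * ‖x‖) := Real.add_one_le_exp _
      have e3 : 0 ≤ f x := expDensity_nonneg x
      have e4 : h * (2 * n) * Bᶜ.indicator f x ≤ h * ‖x‖ * f x := by
        by_cases hxB : x ∈ B
        · rw [Set.indicator_of_notMem (by simpa using hxB), mul_zero]
          positivity
        · rw [Set.indicator_of_mem (by simpa using hxB)]
          have : 2 * (n : ℝ) < ‖x‖ := by simpa [hB] using hxB
          gcongr
      show f x + h * (2 * n) * Bᶜ.indicator f x ≤ f ((1 - h) • x)
      rw [e1]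
      nlinarith
    · have e1 : f x = 0 := Set.indicator_of_notMem hx _
      have e2 : f ((1 - h) • x) = 0 := Set.indicator_of_notMem (fun h' => hx (hmem.2 h')) _
      have e3 : Bᶜ.indicator f x = 0 := by
        exact Set.indicator_apply_eq_zero.2 fun _ => e1
      show f x + h * (2 * n) * Bᶜ.indicator f x ≤ f ((1 - h) • x)
      rw [e1, e2, e3]
      simp
  have hq2 : q ≤ 1 / 2 := by
    by_contra! hq2
    have hq1 : 0 < q := by linarith
    set h := (q - 1 / 2) / (2 * n * q) with hh
    have hhpos : 0 < h := div_pos (by linarith) (by positivity)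
    have hnq : n * h * q = (q - 1 / 2) / 2 := by rw [hh]; field_simp
    have hn1 : (1 : ℝ) ≤ n := by exact_mod_cast Nat.one_le_iff_ne_zero.2 hn
    have hnh : n * h ≤ 1 / 2 := by
      have : n * h * q ≤ 1 / 2 * q := by rw [hnq]; linarith
      exact le_of_mul_le_mul_right this hq1
    have hh1 : h < 1 := by nlinarith
    have hk := key h hhpos hh1
    have hbern : 1 - n * h ≤ (1 - h) ^ n := by
      have := one_add_mul_le_pow (a := -h) (by linarith) n
      rw [← sub_eq_add_neg] at this
      linarith
    have hpow : 0 < (1 - h) ^ n := pow_pos (by linarith) n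
    have h3 : (1 + h * (2 * n) * q) * (1 - n * h) ≤ 1 := by
      have h4 := mul_le_mul hk hbern (by linarith) (by positivity)
      rwa [inv_mul_cancel₀ hpow.ne'] at h4
    have h5 : h * (2 * n) * q = q - 1 / 2 := by linarith
    rw [h5] at h3
    nlinarith
  have := probReal_add_probReal_compl (μ := expLaw S) hBm
  linarith

end ExponentialLaw

section EnteringProbability

variable {m n : ℕ} {a : Fin m → EuclideanSpace ℝ (Fin n)} {b : Fin m → ℝ}

/-- A predicate on `[0, 1]` that fails at `0` but holds somewhere starts to hold within one of
the `k` steps of a uniform subdivision. -/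
lemma exists_entering_step {Q : ℝ → Prop} {k : ℕ} (hk : 0 < k) (h0 : ¬ Q 0) {r : ℝ}
    (hr : r ∈ Set.Icc (0 : ℝ) 1) (hQ : Q r) :
    ∃ j < k, ¬ Q (j / k) ∧ ∃ s ∈ Set.Icc ((j : ℝ) / k) ((j + 1) / k), Q s := by
  classical
  have hk' : (0 : ℝ) < k := by exact_mod_cast hk
  have hex : ∃ i : ℕ, ∃ s ∈ Set.Icc ((i : ℝ) / k) ((i + 1) / k), Q s := by
    refine ⟨⌊r * k⌋₊, r, ⟨?_, ?_⟩, hQ⟩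
    · rw [div_le_iff₀ hk']
      exact Nat.floor_le (mul_nonneg hr.1 hk'.le)
    · rw [le_div_iff₀ hk']
      exact (Nat.lt_floor_add_one _).le
  have hfind := Nat.find_spec hex
  set i := Nat.find hex with hi
  have hnot : ¬ Q (i / k) := by
    intro h
    rcases Nat.eq_zero_or_pos i with hi0 | hi0
    · rw [hi0] at h
      simp only [Nat.cast_zero, zero_div] at h
      exact h0 h
    · refine Nat.find_min hex (m := i - 1) (by omega) ⟨_, ⟨?_, ?_⟩, h⟩
      · gcongr
        omega
      · rw [Nat.cast_sub hi0, Nat.cast_one, sub_add_cancel]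
  refine ⟨i, ?_, hnot, hfind⟩
  by_contra! hki
  have hle : i ≤ ⌊r * k⌋₊ := Nat.find_min' hex (by
    refine ⟨r, ⟨?_, ?_⟩, hQ⟩
    · rw [div_le_iff₀ hk']
      exact Nat.floor_le (mul_nonneg hr.1 hk'.le)
    · rw [le_div_iff₀ hk']
      exact (Nat.lt_floor_add_one _).le)
  have h1 : (i : ℝ) ≤ r * k := (Nat.le_floor_iff (mul_nonneg hr.1 hk'.le)).1 hle
  have h2 : (k : ℝ) ≤ i := by exact_mod_cast hki
  have hr1 : r = 1 := by
    refine le_antisymm hr.2 ?_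
    nlinarith [hr.2]
  have h3 : (i : ℝ) = k := le_antisymm (by rw [hr1, one_mul] at h1; exact h1) h2
  rw [h3, div_self hk'.ne', ← hr1] at hnot
  exact hnot hQ

lemma add_smul_mem_normalCone {v y p z : EuclideanSpace ℝ (Fin n)} {τ M : ℝ} (hτ : 0 < τ)
    (hy : Metric.closedBall y τ ⊆ normalCone a b v) (hz : ‖z‖ ≤ M)
    (hp : p + z ∈ normalCone a b v) : p + (M / τ) • y ∈ normalCone a b v := by
  rcases ((norm_nonneg z).trans hz).eq_or_lt with hM | hM
  · have : z = 0 := norm_le_zero_iff.1 (hM ▸ hz)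
    simpa [← hM, this] using hp
  · have hball : y - (τ / M) • z ∈ Metric.closedBall y τ := by
      rw [mem_closedBall_iff_norm, sub_sub_cancel_left, norm_neg, norm_smul,
        Real.norm_of_nonneg (by positivity), div_mul_eq_mul_div, div_le_iff₀ hM]
      exact mul_le_mul_of_nonneg_left hz hτ.le
    have h := add_mem_normalCone hp (smul_mem_normalCone (r := M / τ) (by positivity) (hy hball))
    have e : M / τ * (τ / M) = 1 := by field_simp
    rwa [smul_sub, smul_smul, e, one_smul, add_assoc, add_sub_cancel] at h

lemma sum_measureReal_translate_le_one [Fintype ((polyhedron a b).extremePoints ℝ)]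
    (hfull : (interior (polyhedron a b)).Nonempty)
    {μ : Measure (EuclideanSpace ℝ (Fin n))} [IsProbabilityMeasure μ] (hμ : μ ≪ volume)
    (p : EuclideanSpace ℝ (Fin n)) :
    ∑ u : (polyhedron a b).extremePoints ℝ, μ.real {x | p + x ∈ normalCone a b u} ≤ 1 := by
  have hmeas : ∀ u : (polyhedron a b).extremePoints ℝ,
      MeasurableSet {x | p + x ∈ normalCone a b u} := fun u =>
    ((isClosed_normalCone hfull u.2.1).preimage (continuous_const.add continuous_id)).measurableSet
  have hdisj : Set.Pairwise
      ((Finset.univ : Finset ((polyhedron a b).extremePoints ℝ)) : Set _)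
      (Function.onFun (AEDisjoint μ) fun u : (polyhedron a b).extremePoints ℝ => {x | p + x ∈ normalCone a b u}) := by
    intro u _ w _ huw
    refine measure_eq_zero_iff_ae_notMem.2 ?_
    filter_upwards [hμ.ae_le (ae_eq_of_mem_normalCone hfull p)] with x hx h
    exact huw (hx u w h.1 h.2)
  rw [← measureReal_biUnion_finset₀ hdisj fun u _ => (hmeas u).nullMeasurableSet]
  exact measureReal_le_one

/-- If entering the normal cone of `u` happens in one of `k` steps, each of which can be undone by
a translation of length `η` into the cone, the expected number of entered cones is at most
`k (exp η - 1)`. -/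
lemma sum_measureReal_entering_le [Fintype ((polyhedron a b).extremePoints ℝ)]
    (hp : IsPointedSystem a) (hfull : (interior (polyhedron a b)).Nonempty)
    [IsProbabilityMeasure (expLaw (fanSupport a b))] {τ : ℝ} (hτ : 0 < τ)
    {y : (polyhedron a b).extremePoints ℝ → EuclideanSpace ℝ (Fin n)} (hy : ∀ u, ‖y u‖ = 1)
    (hball : ∀ u, Metric.closedBall (y u) τ ⊆ normalCone a b u) {k : ℕ} {η : ℝ} (hη : 0 ≤ η)
    {p : ℕ → EuclideanSpace ℝ (Fin n)}
    {A : (polyhedron a b).extremePoints ℝ → Set (EuclideanSpace ℝ (Fin n))}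
    (hA : ∀ u, ∀ᵐ x ∂expLaw (fanSupport a b), x ∈ A u → ∃ j < k, p j + x ∉ normalCone a b u ∧
      p j + x + η • y u ∈ normalCone a b u) :
    ∑ u, (expLaw (fanSupport a b)).real (A u) ≤ k * (Real.exp η - 1) := by
  set μ := expLaw (fanSupport a b) with hμ
  have hS : MeasurableSet (fanSupport a b) := (isClosed_fanSupport hfull).measurableSet
  have hyN : ∀ u : (polyhedron a b).extremePoints ℝ,
      y u ∈ normalCone a b u := fun u => hball u (Metric.mem_closedBall_self hτ.le)
  have hstep : ∀ (u : (polyhedron a b).extremePoints ℝ) (j : ℕ),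
      μ.real {x | p j + x ∉ normalCone a b u ∧
      p j + x + η • y u ∈ normalCone a b u} ≤
      (Real.exp η - 1) * μ.real {x | p j + x ∈ normalCone a b u} := by
    intro u j
    have h := measureReal_expLaw_preimage_diff_le (S := fanSupport a b) hS (z := η • y u) (η := η)
      (by rw [norm_smul, hy u, mul_one, Real.norm_of_nonneg hη])
      (fun x hx => add_mem_fanSupport hp hfull hx
        (smul_mem_fanSupport hη (normalCone_subset_fanSupport u.2 (hyN u))))
      (A := {x | p j + x ∈ normalCone a b u})
      ((isClosed_normalCone hfull u.2.1).preimage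
        (continuous_const.add continuous_id)).measurableSet
      (fun x hx => by
        show p j + (x + η • y u) ∈ normalCone a b u
        rw [← add_assoc]
        exact add_mem_normalCone hx (smul_mem_normalCone hη (hyN u)))
    simpa only [Set.mem_ofPred_eq, add_assoc] using h
  have hle : ∀ u, μ.real (A u) ≤ ∑ j ∈ Finset.range k,
      (Real.exp η - 1) * μ.real {x | p j + x ∈ normalCone a b u} := by
    intro u
    have h1 : μ.real (A u) ≤ μ.real (⋃ j ∈ Finset.range k, {x | p j + x ∉ normalCone a b u ∧
        p j + x + η • y u ∈ normalCone a b u}) := by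
      refine ENNReal.toReal_mono (measure_ne_top _ _) (measure_mono_ae ?_)
      filter_upwards [hA u] with x hx hxA
      obtain ⟨j, hj, h⟩ := hx hxA
      exact Set.mem_biUnion (Finset.mem_coe.2 (Finset.mem_range.2 hj)) h
    exact h1.trans ((measureReal_biUnion_finset_le _ _).trans
      (Finset.sum_le_sum fun j _ => hstep u j))
  calc ∑ u, μ.real (A u) ≤ ∑ u : (polyhedron a b).extremePoints ℝ, ∑ j ∈ Finset.range k,
        (Real.exp η - 1) * μ.real {x | p j + x ∈ normalCone a b u} :=
        Finset.sum_le_sum fun u _ => hle u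
    _ = ∑ j ∈ Finset.range k, (Real.exp η - 1) *
        ∑ u : (polyhedron a b).extremePoints ℝ, μ.real {x | p j + x ∈ normalCone a b u} := by
        rw [Finset.sum_comm]
        simp_rw [Finset.mul_sum]
    _ ≤ ∑ j ∈ Finset.range k, (Real.exp η - 1) * 1 := by
        refine Finset.sum_le_sum fun j _ => mul_le_mul_of_nonneg_left
          (sum_measureReal_translate_le_one hfull expLaw_absolutelyContinuous _) ?_
        linarith [Real.one_le_exp hη]
    _ = k * (Real.exp η - 1) := by simp [mul_sub]

lemma le_of_forall_le_nat_mul {f : ℝ → ℝ} {f' X : ℝ} (hf : HasDerivAt f f' 0) (h0 : f 0 = 0)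
    (hX : ∀ k : ℕ, 0 < k → X ≤ k * f (1 / k)) : X ≤ f' := by
  have h := hasDerivAt_iff_tendsto_slope_zero.1 hf
  have hk : Filter.Tendsto (fun k : ℕ => 1 / (k : ℝ)) Filter.atTop (nhdsWithin 0 {0}ᶜ) := by
    refine tendsto_nhdsWithin_iff.2 ⟨tendsto_one_div_atTop_nhds_zero_nat, ?_⟩
    filter_upwards [Filter.eventually_gt_atTop 0] with k hk
    have : (k : ℝ) ≠ 0 := by exact_mod_cast hk.ne'
    simpa using this
  refine ge_of_tendsto (h.comp hk) ?_
  filter_upwards [Filter.eventually_gt_atTop 0] with k hk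
  simpa [h0] using hX k hk

/-- Expected number of normal cones entered along a translated segment. -/
lemma sum_measureReal_segment_le [Fintype ((polyhedron a b).extremePoints ℝ)]
    (hp : IsPointedSystem a) (hfull : (interior (polyhedron a b)).Nonempty)
    [IsProbabilityMeasure (expLaw (fanSupport a b))] {τ : ℝ} (hτ : 0 < τ)
    {y : (polyhedron a b).extremePoints ℝ → EuclideanSpace ℝ (Fin n)} (hy : ∀ u, ‖y u‖ = 1)
    (hball : ∀ u, Metric.closedBall (y u) τ ⊆ normalCone a b u)
    (c δ : EuclideanSpace ℝ (Fin n)) :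
    ∑ u : (polyhedron a b).extremePoints ℝ, (expLaw (fanSupport a b)).real
      {x | u ∈ enteredVertices a b (c + x) δ} ≤ ‖δ‖ / τ := by
  have hderiv : HasDerivAt (fun t : ℝ => Real.exp (t * (‖δ‖ / τ)) - 1) (‖δ‖ / τ) 0 := by
    have := (((hasDerivAt_id (0 : ℝ)).mul_const (‖δ‖ / τ)).exp).sub_const 1
    simpa using this
  refine le_of_forall_le_nat_mul hderiv (by simp) fun k hk => ?_
  have hk' : (0 : ℝ) < k := by exact_mod_cast hk
  refine sum_measureReal_entering_le hp hfull hτ hy hball (by positivity)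
    (p := fun j => c + ((j : ℝ) / k) • δ) fun u => Filter.Eventually.of_forall fun x hx => ?_
  obtain ⟨h0, r, hr, hQ⟩ := hx
  obtain ⟨j, hj, hj1, s, hs, hs1⟩ := exists_entering_step
    (Q := fun r => c + x + r • δ ∈ normalCone a b u) hk (by simpa using h0) hr hQ
  refine ⟨j, hj, ?_, ?_⟩
  · rwa [add_right_comm]
  · have e : 1 / (k : ℝ) * (‖δ‖ / τ) = (1 / k * ‖δ‖) / τ := by ring
    rw [e]
    refine add_smul_mem_normalCone hτ (hball u) (z := (s - j / k) • δ) ?_ ?_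
    · rw [norm_smul, Real.norm_of_nonneg (by linarith [hs.1])]
      refine mul_le_mul_of_nonneg_right ?_ (norm_nonneg _)
      have := hs.2
      rw [add_div] at this
      linarith
    · have e2 : c + ((j : ℝ) / k) • δ + x + (s - j / k) • δ = c + x + s • δ := by module
      rw [e2]
      exact hs1

/-- Expected number of normal cones entered along a random ray from the centre of a ball in a
normal cone. -/
lemma sum_measureReal_ray_le [Fintype ((polyhedron a b).extremePoints ℝ)]
    (hp : IsPointedSystem a) (hfull : (interior (polyhedron a b)).Nonempty)
    [IsProbabilityMeasure (expLaw (fanSupport a b))] {τ : ℝ} (hτ : 0 < τ) (hτ1 : τ ≤ 1)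
    {y : (polyhedron a b).extremePoints ℝ → EuclideanSpace ℝ (Fin n)} (hy : ∀ u, ‖y u‖ = 1)
    (hball : ∀ u, Metric.closedBall (y u) τ ⊆ normalCone a b u)
    {c : EuclideanSpace ℝ (Fin n)} {v : (polyhedron a b).extremePoints ℝ} {R : ℝ} (hR : 0 < R)
    (hc : Metric.closedBall c (τ * R) ⊆ normalCone a b v) :
    ∑ u : (polyhedron a b).extremePoints ℝ, (expLaw (fanSupport a b)).real
      {x | x ∈ Metric.closedBall 0 R ∧ u ∈ enteredVertices a b c x} ≤
        R / τ * Real.log (1 / τ) := by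
  set ℓ := Real.log (1 / τ) with hℓ
  have hℓ0 : 0 ≤ ℓ := Real.log_nonneg (by rw [le_div_iff₀ hτ]; linarith)
  have hexpℓ : τ * Real.exp ℓ = 1 := by
    rw [hℓ, Real.exp_log (by positivity)]; field_simp
  have hderiv : HasDerivAt (fun t : ℝ => Real.exp ((Real.exp (t * ℓ) - 1) * (R / τ)) - 1)
      (R / τ * ℓ) 0 := by
    have := ((((((hasDerivAt_id (0 : ℝ)).mul_const ℓ).exp).sub_const 1).mul_const
      (R / τ)).exp).sub_const 1
    simpa [mul_comm] using this
  refine le_of_forall_le_nat_mul hderiv (by simp) fun k hk => ?_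
  have hk' : (0 : ℝ) < k := by exact_mod_cast hk
  have hq : 0 ≤ Real.exp (1 / k * ℓ) - 1 := by
    linarith [Real.one_le_exp (show 0 ≤ 1 / (k : ℝ) * ℓ by positivity)]
  set lam : ℝ → ℝ := fun t => τ * Real.exp (t * ℓ) with hlam
  have hlampos : ∀ t, 0 < lam t := fun t => mul_pos hτ (Real.exp_pos _)
  refine sum_measureReal_entering_le hp hfull hτ hy hball
    (mul_nonneg hq (by positivity)) (p := fun j => (lam (j / k))⁻¹ • c) fun u => ?_
  filter_upwards [expLaw_absolutelyContinuous.ae_le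
    (ae_eq_of_mem_normalCone (a := a) (b := b) hfull (τ⁻¹ • c))] with x hx hxA
  obtain ⟨hxR, h0, r, hr, hQ⟩ := hxA
  rw [mem_closedBall_zero_iff] at hxR
  have hscale : ∀ (t : ℝ), 0 < t → ∀ w : (polyhedron a b).extremePoints ℝ,
      (c + t • x ∈ normalCone a b w ↔ t⁻¹ • c + x ∈ normalCone a b w) := by
    intro t ht w
    constructor
    · intro h
      have := smul_mem_normalCone (inv_nonneg.2 ht.le) h
      rwa [smul_add, smul_smul, inv_mul_cancel₀ ht.ne', one_smul] at this
    · intro h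
      have := smul_mem_normalCone ht.le h
      rwa [smul_add, smul_smul, mul_inv_cancel₀ ht.ne', one_smul] at this
  have huv : u ≠ v := fun h => h0 (h ▸ hc (Metric.mem_closedBall_self (by positivity)))
  have hτr : τ ≤ r := by
    by_contra! hlt
    have hnorm : ‖r • x‖ ≤ r * R := by
      rw [norm_smul, Real.norm_of_nonneg hr.1]
      exact mul_le_mul_of_nonneg_left hxR hr.1
    refine huv (Subtype.ext ((mem_normalCone_iff_eq_of_closedBall hfull
      (τ := τ * R - r * R) (by nlinarith) v.2.1 ?_ u.2.1).1 hQ))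
    refine (Metric.closedBall_subset_closedBall' ?_).trans hc
    rw [dist_eq_norm, add_sub_cancel_left]
    linarith
  have hstart : ¬ (c + lam 0 • x ∈ normalCone a b u) := by
    have e : lam 0 = τ := by simp [hlam]
    rw [e]
    intro h
    have hv : c + τ • x ∈ normalCone a b v := hc (by
      rw [mem_closedBall_iff_norm, add_sub_cancel_left, norm_smul, Real.norm_of_nonneg hτ.le]
      exact mul_le_mul_of_nonneg_left hxR hτ.le)
    exact huv (hx u v ((hscale τ hτ u).1 h) ((hscale τ hτ v).1 hv))
  obtain ⟨t, ht, htr⟩ : ∃ t ∈ Set.Icc (0 : ℝ) 1, lam t = r := by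
    have hcont : ContinuousOn lam (Set.Icc 0 1) := by fun_prop
    refine intermediate_value_Icc zero_le_one hcont ⟨?_, ?_⟩
    · simpa [hlam] using hτr
    · simpa [hlam, hexpℓ] using hr.2
  obtain ⟨j, hj, hj1, s, hs, hs1⟩ := exists_entering_step
    (Q := fun t => c + lam t • x ∈ normalCone a b u) hk hstart ht (by rw [htr]; exact hQ)
  have hj0 := hlampos (j / k)
  refine ⟨j, hj, fun h => hj1 ((hscale _ hj0 u).2 h), ?_⟩
  rw [← mul_div_assoc]
  refine add_smul_mem_normalCone hτ (hball u) (z := ((lam (j / k))⁻¹ * lam s - 1) • x) ?_ ?_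
  · have hratio : (lam (j / k))⁻¹ * lam s = Real.exp ((s - j / k) * ℓ) := by
      rw [inv_mul_eq_div, div_eq_iff hj0.ne', hlam, mul_left_comm, ← Real.exp_add]
      ring_nf
    have h1 : 1 ≤ (lam (j / k))⁻¹ * lam s := by
      rw [hratio]
      exact Real.one_le_exp (mul_nonneg (by linarith [hs.1]) hℓ0)
    have h2 : (lam (j / k))⁻¹ * lam s ≤ Real.exp (1 / k * ℓ) := by
      rw [hratio]
      refine Real.exp_le_exp.2 (mul_le_mul_of_nonneg_right ?_ hℓ0)
      have := hs.2
      rw [add_div] at this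
      linarith
    rw [norm_smul, Real.norm_of_nonneg (by linarith)]
    exact mul_le_mul (by linarith) hxR (norm_nonneg _) hq
  · have := smul_mem_normalCone (inv_nonneg.2 hj0.le) hs1
    have e : (lam (j / k))⁻¹ • c + x + ((lam (j / k))⁻¹ * lam s - 1) • x =
        (lam (j / k))⁻¹ • (c + lam s • x) := by module
    rw [e]
    exact this

end EnteringProbability

section ExpectedLength

variable {m n : ℕ} {a : Fin m → EuclideanSpace ℝ (Fin n)} {b : Fin m → ℝ}

lemma isClosed_exists_mem_Icc {D : Set (EuclideanSpace ℝ (Fin n))} (hD : IsClosed D)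
    {f : ℝ × EuclideanSpace ℝ (Fin n) → EuclideanSpace ℝ (Fin n)} (hf : Continuous f) :
    IsClosed {x | ∃ r ∈ Set.Icc (0 : ℝ) 1, f (r, x) ∈ D} := by
  have hc : Continuous fun q : Set.Icc (0 : ℝ) 1 × EuclideanSpace ℝ (Fin n) =>
      f ((q.1 : ℝ), q.2) := by fun_prop
  have h := isClosedMap_snd_of_compactSpace (X := Set.Icc (0 : ℝ) 1) _ (hD.preimage hc)
  convert h using 1
  ext x
  constructor
  · rintro ⟨r, hr, hx⟩
    exact ⟨(⟨r, hr⟩, x), hx, rfl⟩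
  · rintro ⟨⟨r, y⟩, hy, rfl⟩
    exact ⟨r, r.2, hy⟩

lemma measurableSet_mem_enteredVertices (hfull : (interior (polyhedron a b)).Nonempty)
    {p δ : EuclideanSpace ℝ (Fin n) → EuclideanSpace ℝ (Fin n)} (hp : Continuous p)
    (hδ : Continuous δ) (u : (polyhedron a b).extremePoints ℝ) :
    MeasurableSet {x | u ∈ enteredVertices a b (p x) (δ x)} := by
  have hD := isClosed_normalCone hfull u.2.1
  have h1 : MeasurableSet {x | p x ∉ normalCone a b u} :=
    (hD.preimage hp).measurableSet.compl
  have h2 : MeasurableSet {x | ∃ r ∈ Set.Icc (0 : ℝ) 1, p x + r • δ x ∈ normalCone a b u} :=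
    (isClosed_exists_mem_Icc hD (f := fun q => p q.2 + q.1 • δ q.2) (by fun_prop)).measurableSet
  exact h1.inter h2

lemma integrable_ncard_and_integral {α ι : Type*} [MeasurableSpace α] [Fintype ι] {κ : Measure α}
    [IsFiniteMeasure κ] {T : α → Set ι} (hT : ∀ u, MeasurableSet {x | u ∈ T x}) :
    Integrable (fun x => ((T x).ncard : ℝ)) κ ∧
      ∫ x, ((T x).ncard : ℝ) ∂κ = ∑ u, κ.real {x | u ∈ T x} := by
  classical
  have h : (fun x => ((T x).ncard : ℝ)) =
      fun x => ∑ u, Set.indicator {x | u ∈ T x} (fun _ => (1 : ℝ)) x := by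
    ext x
    rw [Set.ncard_eq_toFinset_card', Finset.card_eq_sum_ones, Nat.cast_sum]
    simp [Set.indicator_apply]
  have hint : ∀ u, Integrable (Set.indicator {x | u ∈ T x} fun _ => (1 : ℝ)) κ := fun u =>
    (integrable_const 1).indicator (hT u)
  rw [h]
  refine ⟨integrable_finsetSum _ fun u _ => hint u, ?_⟩
  rw [integral_finsetSum _ fun u _ => hint u]
  refine Finset.sum_congr rfl fun u _ => ?_
  rw [integral_indicator (hT u), setIntegral_const, smul_eq_mul, mul_one]

lemma tau_le_one (hfull : (interior (polyhedron a b)).Nonempty) {τ : ℝ} (hτ : 0 < τ)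
    {v y : EuclideanSpace ℝ (Fin n)} (hv : v ∈ polyhedron a b) (hy : ‖y‖ = 1)
    (hball : Metric.closedBall y τ ⊆ normalCone a b v) : τ ≤ 1 := by
  have : Nontrivial (EuclideanSpace ℝ (Fin n)) :=
    ⟨y, 0, fun h => by rw [h, norm_zero] at hy; exact zero_ne_one hy⟩
  obtain ⟨x, hx, hxv⟩ : ∃ x ∈ polyhedron a b, x ≠ v := by
    by_contra! h
    have : interior (polyhedron a b) ⊆ interior {v} := interior_mono fun x hx => h x hx
    rw [interior_singleton] at this
    exact hfull.not_subset_empty this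
  have hn : 0 < ‖x - v‖ := norm_pos_iff.2 (sub_ne_zero.2 hxv)
  have h := ((mem_normalCone_iff hfull hv).1 (hball (show y + (τ / ‖x - v‖) • (x - v) ∈
    Metric.closedBall y τ by
      rw [mem_closedBall_iff_norm, add_sub_cancel_left, norm_smul,
        Real.norm_of_nonneg (by positivity), div_mul_cancel₀ _ hn.ne']))).2 x hx
  rw [← sub_nonpos, ← inner_sub_right, inner_add_left, inner_smul_left,
    real_inner_self_eq_norm_sq] at h
  simp only [conj_trivial] at h
  have h1 : τ / ‖x - v‖ * ‖x - v‖ ^ 2 = τ * ‖x - v‖ := by field_simp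
  have h2 := neg_le_of_abs_le (abs_real_inner_le_norm y (x - v))
  rw [hy, one_mul] at h2
  exact le_of_mul_le_mul_right (by linarith) hn

lemma closedBall_smul_subset_normalCone {v c : EuclideanSpace ℝ (Fin n)} {τ s ρ : ℝ}
    (hs : 0 < s) (hρ : ρ ≤ s * τ) (hc : Metric.closedBall c τ ⊆ normalCone a b v) :
    Metric.closedBall (s • c) ρ ⊆ normalCone a b v := by
  intro x hx
  have h : s⁻¹ • x ∈ Metric.closedBall c τ := by
    rw [mem_closedBall_iff_norm] at hx ⊢
    have e : s⁻¹ • x - c = s⁻¹ • (x - s • c) := by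
      rw [smul_sub, smul_smul, inv_mul_cancel₀ hs.ne', one_smul]
    rw [e, norm_smul, Real.norm_of_nonneg (by positivity), inv_mul_le_iff₀ hs]
    linarith
  have := smul_mem_normalCone hs.le (hc h)
  rwa [smul_smul, mul_inv_cancel₀ hs.ne', one_smul] at this

lemma measureReal_cond_le {α : Type*} [MeasurableSpace α] {μ : Measure α}
    [IsProbabilityMeasure μ] {B : Set α} (hB : MeasurableSet B) (hhalf : 1 / 2 ≤ μ.real B)
    (T : Set α) : (μ[|B]).real T ≤ 2 * μ.real {x | x ∈ B ∧ x ∈ T} := by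
  rw [Measure.real, cond_apply hB, ENNReal.toReal_mul, ENNReal.toReal_inv]
  refine mul_le_mul_of_nonneg_right ?_ measureReal_nonneg
  rw [← Measure.real, inv_le_comm₀ (by linarith) two_pos]
  linarith

/-- The random three-leg shadow simplex path between two vertices of a wide polyhedron has expected
length at most `8 n / τ * (1 + log (1 / τ))`. -/
lemma exists_threeLegShadowPath_integral_le (hp : IsPointedSystem a)
    (hfull : (interior (polyhedron a b)).Nonempty) {τ : ℝ} (hτ : 0 < τ)
    (hwide : IsWidePolyhedron a b τ) (hn : n ≠ 0)
    [IsProbabilityMeasure (expLaw (fanSupport a b))]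
    (hhalf : 1 / 2 ≤ (expLaw (fanSupport a b)).real (Metric.closedBall 0 (2 * n)))
    [IsProbabilityMeasure ((expLaw (fanSupport a b))[|Metric.closedBall 0 (2 * n)])]
    {v w : (polyhedron a b).extremePoints ℝ} (hvw : v ≠ w) {c d : EuclideanSpace ℝ (Fin n)}
    (hc1 : ‖c‖ = 1) (hd1 : ‖d‖ = 1) (hc : Metric.closedBall c τ ⊆ normalCone a b v)
    (hd : Metric.closedBall d τ ⊆ normalCone a b w) :
    ∃ path : EuclideanSpace ℝ (Fin n) → (vertexGraph (polyhedron a b)).Walk v w,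
      (∀ᵐ x ∂((expLaw (fanSupport a b))[|Metric.closedBall 0 (2 * n)]),
        IsThreeLegShadowPath (polyhedron a b)
          ((4 * n / ‖d - c‖) • c) ((4 * n / ‖d - c‖) • d) x (path x)) ∧
      Integrable (fun x => ((path x).length : ℝ))
        ((expLaw (fanSupport a b))[|Metric.closedBall 0 (2 * n)]) ∧
      ∫ x, ((path x).length : ℝ) ∂((expLaw (fanSupport a b))[|Metric.closedBall 0 (2 * n)]) ≤
        8 * n / τ * (1 + Real.log (1 / τ)) := by
  classical
  have : Fintype ((polyhedron a b).extremePoints ℝ) := finite_extremePoints_polyhedron.fintype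
  set B : Set (EuclideanSpace ℝ (Fin n)) := Metric.closedBall 0 (2 * n) with hB
  have hBm : MeasurableSet B := Metric.isClosed_closedBall.measurableSet
  set κ := (expLaw (fanSupport a b))[|B] with hκ
  have hκμ : κ ≪ expLaw (fanSupport a b) := cond_absolutelyContinuous
  have hn0 : (0 : ℝ) < n := by positivity
  have hτ1 : τ ≤ 1 := tau_le_one hfull hτ v.2.1 hc1 hc
  have hdc : d - c ≠ 0 := fun h => hvw (Subtype.ext
    ((mem_normalCone_iff_eq_of_closedBall hfull hτ w.2.1 hd v.2.1).1
      (by rw [sub_eq_zero.1 h]; exact hc (Metric.mem_closedBall_self hτ.le))))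
  have hdc0 : 0 < ‖d - c‖ := norm_pos_iff.2 hdc
  have hdc2 : ‖d - c‖ ≤ 2 := (norm_sub_le d c).trans (by rw [hc1, hd1]; norm_num)
  set s := 4 * (n : ℝ) / ‖d - c‖ with hs
  have hs0 : 0 < s := by positivity
  have hs2 : 2 * (n : ℝ) ≤ s := by
    rw [hs, le_div_iff₀ hdc0]
    nlinarith
  have hsdc : ‖s • d - s • c‖ = 4 * n := by
    rw [← smul_sub, norm_smul, Real.norm_of_nonneg hs0.le, hs, div_mul_cancel₀ _ hdc0.ne']
  have hρ : τ * (2 * n) ≤ s * τ := by nlinarith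
  have hcb := closedBall_smul_subset_normalCone hs0 hρ hc
  have hdb := closedBall_smul_subset_normalCone hs0 hρ hd
  have hex := ae_exists_threeLegShadowPath hp hfull (show 0 < τ * (2 * n) by positivity) hcb hdb
  set c' := s • c with hc'
  set d' := s • d with hd'
  have hex' : ∀ᵐ x ∂κ, ∃ p : (vertexGraph (polyhedron a b)).Walk v w,
      IsThreeLegShadowPath (polyhedron a b) c' d' x p ∧ p.length =
        (enteredVertices a b c' x).ncard + (enteredVertices a b (c' + x) (d' - c')).ncard +
          (enteredVertices a b d' x).ncard := by
    filter_upwards [hκμ.ae_le (expLaw_absolutelyContinuous.ae_le hex),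
      hκμ.ae_le (ae_mem_expLaw (isClosed_fanSupport hfull).measurableSet)] with x h1 h2
    exact h1 h2
  obtain ⟨x₀, p₀, -⟩ := hex'.exists
  let path : EuclideanSpace ℝ (Fin n) → (vertexGraph (polyhedron a b)).Walk v w := fun x =>
    if h : ∃ p : (vertexGraph (polyhedron a b)).Walk v w,
      IsThreeLegShadowPath (polyhedron a b) c' d' x p ∧ p.length =
        (enteredVertices a b c' x).ncard + (enteredVertices a b (c' + x) (d' - c')).ncard +
          (enteredVertices a b d' x).ncard then h.choose else p₀
  have hpath : ∀ᵐ x ∂κ, IsThreeLegShadowPath (polyhedron a b) c' d' x (path x) ∧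
      (path x).length =
        (enteredVertices a b c' x).ncard + (enteredVertices a b (c' + x) (d' - c')).ncard +
          (enteredVertices a b d' x).ncard := by
    filter_upwards [hex'] with x hx
    simp only [path, dif_pos hx]
    exact hx.choose_spec
  obtain ⟨i₁, e₁⟩ := integrable_ncard_and_integral (κ := κ)
    (T := fun x => enteredVertices a b c' x)
    (measurableSet_mem_enteredVertices hfull continuous_const continuous_id)
  obtain ⟨i₂, e₂⟩ := integrable_ncard_and_integral (κ := κ)
    (T := fun x => enteredVertices a b (c' + x) (d' - c'))
    (measurableSet_mem_enteredVertices hfull (by fun_prop) continuous_const)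
  obtain ⟨i₃, e₃⟩ := integrable_ncard_and_integral (κ := κ)
    (T := fun x => enteredVertices a b d' x)
    (measurableSet_mem_enteredVertices hfull continuous_const continuous_id)
  have hlen : (fun x => ((path x).length : ℝ)) =ᵐ[κ] fun x =>
      ((enteredVertices a b c' x).ncard : ℝ) +
        ((enteredVertices a b (c' + x) (d' - c')).ncard : ℝ) +
        ((enteredVertices a b d' x).ncard : ℝ) := by
    filter_upwards [hpath] with x hx
    rw [hx.2]
    push_cast
    rfl
  refine ⟨path, hpath.mono fun x hx => hx.1, ((i₁.add i₂).add i₃).congr hlen.symm, ?_⟩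
  have i₁₂ : Integrable (fun x => ((enteredVertices a b c' x).ncard : ℝ) +
      ((enteredVertices a b (c' + x) (d' - c')).ncard : ℝ)) κ := i₁.add i₂
  rw [integral_congr_ae hlen, integral_add i₁₂ i₃, integral_add i₁ i₂, e₁, e₂, e₃]
  choose y hy hball using fun u : (polyhedron a b).extremePoints ℝ => hwide u u.2
  have hR : (0 : ℝ) < 2 * n := by positivity
  have b₁ := sum_measureReal_ray_le hp hfull hτ hτ1 hy hball hR hcb
  have b₂ := sum_measureReal_segment_le hp hfull hτ hy hball c' (d' - c')
  have b₃ := sum_measureReal_ray_le hp hfull hτ hτ1 hy hball hR hdb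
  have hcond : ∀ T : (polyhedron a b).extremePoints ℝ → Set (EuclideanSpace ℝ (Fin n)),
      ∑ u, κ.real (T u) ≤ 2 * ∑ u, (expLaw (fanSupport a b)).real {x | x ∈ B ∧ x ∈ T u} :=
    fun T => by
      rw [Finset.mul_sum]
      exact Finset.sum_le_sum fun u _ => measureReal_cond_le hBm hhalf (T u)
  have f₁ := hcond fun u => {x | u ∈ enteredVertices a b c' x}
  have f₂ := hcond fun u => {x | u ∈ enteredVertices a b (c' + x) (d' - c')}
  have f₃ := hcond fun u => {x | u ∈ enteredVertices a b d' x}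
  have f₂' : ∑ u, (expLaw (fanSupport a b)).real
      {x | x ∈ B ∧ x ∈ {x | u ∈ enteredVertices a b (c' + x) (d' - c')}} ≤ 4 * n / τ := by
    rw [← hsdc]
    exact (Finset.sum_le_sum fun u _ => measureReal_mono fun x hx => hx.2).trans b₂
  have efin : 8 * n / τ * (1 + Real.log (1 / τ)) = 2 * (2 * n / τ * Real.log (1 / τ)) +
      2 * (4 * n / τ) + 2 * (2 * n / τ * Real.log (1 / τ)) := by ring
  rw [efin]
  refine add_le_add (add_le_add ?_ ?_) ?_
  · exact f₁.trans (mul_le_mul_of_nonneg_left b₁ zero_le_two)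
  · exact f₂.trans (mul_le_mul_of_nonneg_left f₂' zero_le_two)
  · exact f₃.trans (mul_le_mul_of_nonneg_left b₃ zero_le_two)

end ExpectedLength

theorem theorem2 {m n : ℕ} (a : Fin m → EuclideanSpace ℝ (Fin n)) (b : Fin m → ℝ) (τ : ℝ)
    (hτ : 0 < τ) (hpointed : IsPointedSystem a) (hfull : (interior (polyhedron a b)).Nonempty)
    (hwide : IsWidePolyhedron a b τ) :
    -- the graph of the polyhedron is connected and has small diameter
    ((vertexGraph (polyhedron a b)).Connected ∧
      (vertexGraph (polyhedron a b)).ediam ≠ ⊤ ∧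
      ((vertexGraph (polyhedron a b)).diam : ℝ) ≤ 8 * n / τ * (1 + Real.log (1 / τ))) ∧
    -- the exponential distribution on the normal fan, and its conditioning, are well defined
    IsProbabilityMeasure (expLaw (fanSupport a b)) ∧
    IsProbabilityMeasure ((expLaw (fanSupport a b))[|Metric.closedBall 0 (2 * n)]) ∧
    -- the random three-leg shadow simplex path has this expected length
    ∀ (v w : (polyhedron a b).extremePoints ℝ), v ≠ w →
      ∀ c d : EuclideanSpace ℝ (Fin n), ‖c‖ = 1 → ‖d‖ = 1 →
        Metric.closedBall c τ ⊆ normalCone a b v →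
        Metric.closedBall d τ ⊆ normalCone a b w →
        ∃ path : EuclideanSpace ℝ (Fin n) → (vertexGraph (polyhedron a b)).Walk v w,
          (∀ᵐ x ∂((expLaw (fanSupport a b))[|Metric.closedBall 0 (2 * n)]),
            IsThreeLegShadowPath (polyhedron a b)
              ((4 * n / ‖d - c‖) • c) ((4 * n / ‖d - c‖) • d) x (path x)) ∧
          Integrable (fun x => ((path x).length : ℝ))
            ((expLaw (fanSupport a b))[|Metric.closedBall 0 (2 * n)]) ∧
          ∫ x, ((path x).length : ℝ) ∂((expLaw (fanSupport a b))[|Metric.closedBall 0 (2 * n)]) ≤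
            8 * n / τ * (1 + Real.log (1 / τ)) := by
  have hne : (polyhedron a b).Nonempty := hfull.mono interior_subset
  obtain ⟨v₀, hv₀, -⟩ := exists_mem_optimalFace hpointed hne (c := 0) (M := 0) (by simp)
  obtain ⟨y₀, hy₀, hball₀⟩ := hwide v₀ hv₀
  have hn : n ≠ 0 := by
    rintro rfl
    rw [Subsingleton.elim y₀ 0, norm_zero] at hy₀
    exact zero_ne_one hy₀
  have hτ1 : τ ≤ 1 := tau_le_one hfull hτ hv₀.1 hy₀ hball₀
  have hlog : 0 ≤ Real.log (1 / τ) := Real.log_nonneg (by rw [le_div_iff₀ hτ]; linarith)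
  have hS : MeasurableSet (fanSupport a b) := (isClosed_fanSupport hfull).measurableSet
  have hint : (interior (fanSupport a b)).Nonempty := ⟨y₀, mem_interior_iff_mem_nhds.2
    (Filter.mem_of_superset (Metric.closedBall_mem_nhds y₀ hτ)
      (hball₀.trans (normalCone_subset_fanSupport hv₀)))⟩
  have hprob := isProbabilityMeasure_expLaw hn hS hint
  have hhalf := half_le_measureReal_closedBall hn hS hint
    fun r hr x hx => smul_mem_fanSupport hr.le hx
  have hcond : IsProbabilityMeasure
      ((expLaw (fanSupport a b))[|Metric.closedBall 0 (2 * n)]) := by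
    refine cond_isProbabilityMeasure fun h => ?_
    rw [Measure.real, h, ENNReal.toReal_zero] at hhalf
    norm_num at hhalf
  have hmain := fun (v w : (polyhedron a b).extremePoints ℝ) (hvw : v ≠ w)
      (c d : EuclideanSpace ℝ (Fin n)) (hc1 : ‖c‖ = 1) (hd1 : ‖d‖ = 1)
      (hc : Metric.closedBall c τ ⊆ normalCone a b v)
      (hd : Metric.closedBall d τ ⊆ normalCone a b w) =>
    exists_threeLegShadowPath_integral_le hpointed hfull hτ hwide hn hhalf hvw hc1 hd1 hc hd
  refine ⟨?_, hprob, hcond, hmain⟩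
  have hnonneg : 0 ≤ 8 * n / τ * (1 + Real.log (1 / τ)) := by positivity
  have hwalk : ∀ v w : (polyhedron a b).extremePoints ℝ,
      ∃ p : (vertexGraph (polyhedron a b)).Walk v w,
        (p.length : ℝ) ≤ 8 * n / τ * (1 + Real.log (1 / τ)) := by
    intro v w
    by_cases hvw : v = w
    · subst hvw
      exact ⟨SimpleGraph.Walk.nil, by simpa using hnonneg⟩
    obtain ⟨c, hc1, hc⟩ := hwide v v.2
    obtain ⟨d, hd1, hd⟩ := hwide w w.2
    obtain ⟨path, -, hi, hle⟩ := hmain v w hvw c d hc1 hd1 hc hd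
    obtain ⟨x, hx⟩ := exists_le_integral hi
    exact ⟨path x, hx.trans hle⟩
  have : Finite ((polyhedron a b).extremePoints ℝ) := finite_extremePoints_polyhedron
  have : Nonempty ((polyhedron a b).extremePoints ℝ) := ⟨⟨v₀, hv₀⟩⟩
  have hconn : (vertexGraph (polyhedron a b)).Connected :=
    ⟨fun v w => (hwalk v w).elim fun p _ => p.reachable⟩
  refine ⟨hconn, SimpleGraph.connected_iff_ediam_ne_top.1 hconn, ?_⟩
  obtain ⟨v, w, hdist⟩ := (vertexGraph (polyhedron a b)).exists_dist_eq_diam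
  obtain ⟨p, hp⟩ := hwalk v w
  rw [← hdist]
  exact le_trans (by exact_mod_cast SimpleGraph.dist_le p) hp
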